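/- Setting. A causal model on a finite set $V$ of variables is a directed acyclic graph on $V$ with a discrete conditional distribution of each variable given its parents; $P_g(\cdot\mid do(a))$ denotes the interventional distribution of the causal model $g$ (truncated factorization) when the action variable is set to $a$. A causal decision problem consists of: a set $\Omega$ of states with an algebra $\mathcal E$ of events; a finite set $V$ of variables, two different ones of which are distinguished, the action variable, whose values are the actions $a\in\mathcal A$, and the outcome variable, whose values are the consequences $c\in\mathcal C$; for each action $a$ and state $\omega$, the assignment $X^a(\omega)$ of values to all variables that $a$ results in at $\omega$ (the action variable having the value $a$), such that $X^a$ has finitely many values and the events $\{X^a_v=x\}$ belong to $\mathcal E$; a causal model $\mathcal G$ that controls the environment; and a preference relation $\succeq$ on $\mathcal A$. Here a causal model $g$ on $V$ (with the same value sets) is said to control the environment if there is a finitely additive probability $\mu$ on $\mathcal E$ with $P_g(x\mid do(a))=\mu(X^a=x)$ for all actions $a$ and all assignments $x$. The action $a$ is identified with the act $f_a:\Omega\to\mathcal C$, where $f_a(\omega)$ is the value of the outcome variable in $X^a(\omega)$. The preferences $\succeq$ are Savage-rational if there are a set $S$, a surjection $\pi:S\to\Omega$ (a refinement of the states), and a relation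 $\succeq'$ on the set of all finite-valued acts $S\to\mathcal C$ that satisfies Savage's axioms P1 to P6 (all subsets of $S$ being events), such that $a\succeq b$ if and only if $f_a\circ\pi\succeq' f_b\circ\pi$, for all $a,b\in\mathcal A$. Theorem. In a causal decision problem with a finite set $\mathcal A$ of actions, the preferences $\succeq$ are Savage-rational if and only if there are a nonconstant utility function $u:\mathcal C\to\mathbb R$, a family $\mathcal F$ of causal models that control the environment, and a (discrete) probability distribution $P_C$ over $\mathcal F$, such that for all $a,b\in\mathcal A$: $$a\succeq b\iff \sum_{c\in\mathcal C}u(c)\Big(\sum_{g\in\mathcal F}P_g(c\mid do(a))\,P_C(g)\Big)\ \ge\ \sum_{c\in\mathcal C}u(c)\Big(\sum_{g\in\mathcal F}P_g(c\mid do(b))\,P_C(g)\Big).$$ -/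

import Mathlib

/-! ### Causal graphical models and interventions -/

/-- A causal graphical model on the variables `V`, variable `v` taking values in `Val v`: a directed
acyclic graph (`edge w v` says that `w` is a direct cause, i.e. a parent, of `v`) together with, for
each variable, a discrete conditional distribution given the values of its parents. -/
structure CausalModel (V : Type*) (Val : V → Type*) where
  edge : V → V → Prop
  acyclic : ∀ v, ¬ Relation.TransGen edge v v
  cpd : ∀ v, ((w : {w // edge w v}) → Val w) → PMF (Val v)

namespace CausalModel

open Classical in
/-- `P_g(x | do(X = a))` for a full assignment `x` of values to the variables (truncated
factorization): the factor of the variable `X` intervened upon is replaced by the indicator of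
`x X = a`, every other variable keeps its conditional distribution given its parents. -/
noncomputable def doJoint {V : Type*} [Fintype V] {Val : V → Type*} (g : CausalModel V Val)
    (X : V) (a : Val X) (x : (v : V) → Val v) : ENNReal :=
  if x X = a then ∏ v ∈ Finset.univ.erase X, g.cpd v (fun w => x w) (x v) else 0

/-- `P_g(Y = c | do(X = a))`: the marginal of `doJoint` at the variable `Y`. -/
noncomputable def doProb {V : Type*} [Fintype V] {Val : V → Type*} (g : CausalModel V Val)
    (X : V) (a : Val X) (Y : V) (c : Val Y) : ENNReal :=
  ∑' x : {x : (v : V) → Val v // x Y = c}, g.doJoint X a x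

end CausalModel

/-! ### Causal environments and causal decision problems -/

/-- An uncertain environment whose uncertain events are the events that describe the values of the
variables `V`. The actions are the values of the variable `actionVar`, the consequences are the
values of the variable `outcomeVar`. In the state `ω`, action `a` results in the assignment
`response a ω` of values to the variables; each action has finitely many possible results, and
the events `variable v takes the value x under action a` belong to the algebra of events. -/
structure UncertainEnvironment (V : Type*) (Val : V → Type*) (Ω : Type*) where
  events : Set (Set Ω)
  isSetAlgebra_events : MeasureTheory.IsSetAlgebra events
  actionVar : V
  outcomeVar : V
  actionVar_ne_outcomeVar : actionVar ≠ outcomeVar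
  response : Val actionVar → Ω → (v : V) → Val v
  response_actionVar : ∀ a ω, response a ω actionVar = a
  finite_range_response : ∀ a, (Set.range (response a)).Finite
  response_mem_events : ∀ a v (x : Val v), {ω | response a ω v = x} ∈ events

namespace UncertainEnvironment

/-- The set `𝒜` of available actions. -/
abbrev Action {V : Type*} {Val : V → Type*} {Ω : Type*} (D : UncertainEnvironment V Val Ω) :
    Type _ := Val D.actionVar

/-- The set `𝒞` of consequences. -/
abbrev Consequence {V : Type*} {Val : V → Type*} {Ω : Type*} (D : UncertainEnvironment V Val Ω) :
    Type _ := Val D.outcomeVar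

/-- The action `a` as an act `{c_j | E_j : j ∈ J}`: the consequence of `a` in each state. -/
def outcome {V : Type*} {Val : V → Type*} {Ω : Type*} (D : UncertainEnvironment V Val Ω)
    (a : D.Action) (ω : Ω) : D.Consequence :=
  D.response a ω D.outcomeVar

/-- `g` is a causal model of the environment: its interventional distributions are probabilities of
the corresponding events, i.e. for some finitely additive probability `μ` on the algebra of events,
`P_g(x | do(a)) = μ {ω | action a results in x}` for all actions `a` and assignments `x`. -/
def Controls {V : Type*} [Fintype V] {Val : V → Type*} {Ω : Type*}
    (D : UncertainEnvironment V Val Ω) (g : CausalModel V Val) : Prop :=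
  ∃ μ : MeasureTheory.AddContent ENNReal D.events, μ Set.univ = 1 ∧
    ∀ (a : D.Action) (x : (v : V) → Val v),
      g.doJoint D.actionVar a x = μ {ω | D.response a ω = x}

end UncertainEnvironment

/-- A causal environment: an uncertain environment controlled by a causal graphical model. -/
structure CausalEnvironment (V : Type*) [Fintype V] (Val : V → Type*) (Ω : Type*) extends
    UncertainEnvironment V Val Ω where
  model : CausalModel V Val
  controls_model : toUncertainEnvironment.Controls model

/-- A causal decision problem: a causal environment with a preference relation `pref a b`
(`a ⪰ b`) between the available actions. -/
structure CausalDecisionProblem (V : Type*) [Fintype V] (Val : V → Type*) (Ω : Type*) extends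
    CausalEnvironment V Val Ω where
  pref : Val actionVar → Val actionVar → Prop

/-! ### Savage's axioms -/

/-- Savage's (simple) acts: finite-valued functions from states to consequences. -/
def SavageAct (S : Type*) (C : Type*) : Type _ := {f : S → C // (Set.range f).Finite}

namespace SavageAct

/-- The constant act with consequence `x`. -/
def const (S : Type*) {C : Type*} (x : C) : SavageAct S C :=
  ⟨fun _ => x, (Set.finite_singleton x).subset (by rintro _ ⟨_, rfl⟩; rfl)⟩

open Classical in
/-- The act that agrees with `f` on the event `E` and with `h` off `E`. -/
noncomputable def glue {S C : Type*} (E : Set S) (f h : SavageAct S C) : SavageAct S C :=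
  ⟨fun s => if s ∈ E then f.1 s else h.1 s, (f.2.union h.2).subset (by
    rintro _ ⟨s, rfl⟩
    by_cases hs : s ∈ E
    · exact Or.inl ⟨s, by simp [hs]⟩
    · exact Or.inr ⟨s, by simp [hs]⟩)⟩

end SavageAct

/-- Strict preference `f ≻ g`. -/
def StrictPref {α : Type*} (pref : α → α → Prop) (f g : α) : Prop := pref f g ∧ ¬ pref g f

/-- Indifference `f ∼ g`. -/
def Indiff {α : Type*} (pref : α → α → Prop) (f g : α) : Prop := pref f g ∧ pref g f

open SavageAct in
/-- An event is null if changing an act on it never matters. -/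
def NullEvent {S C : Type*} (pref : SavageAct S C → SavageAct S C → Prop) (E : Set S) : Prop :=
  ∀ f g h, Indiff pref (glue E f h) (glue E g h)

open SavageAct in
/-- Savage's axioms P1 to P6 for a preference relation between the acts on a set `S` of states, all
sets of states being events (Savage's P7 only concerns acts with infinitely many values). -/
structure SavageAxioms {S C : Type*} (pref : SavageAct S C → SavageAct S C → Prop) : Prop where
  /-- P1: the preference is complete. -/
  total : ∀ f g, pref f g ∨ pref g f
  /-- P1: the preference is transitive. -/
  trans : ∀ f g h, pref f g → pref g h → pref f h
  /-- P2 (sure-thing principle). -/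
  sure_thing : ∀ E f g h h',
    pref (glue E f h) (glue E g h) ↔ pref (glue E f h') (glue E g h')
  /-- P3 (state independence). -/
  state_independence : ∀ E, ¬ NullEvent pref E → ∀ x y h,
    pref (const S x) (const S y) ↔ pref (glue E (const S x) h) (glue E (const S y) h)
  /-- P4 (comparative probability does not depend on the stakes). -/
  comparative_probability : ∀ (E F : Set S) (x y x' y' : C),
    StrictPref pref (const S x) (const S y) → StrictPref pref (const S x') (const S y') →
      (pref (glue E (const S x) (const S y)) (glue F (const S x) (const S y)) ↔
        pref (glue E (const S x') (const S y')) (glue F (const S x') (const S y')))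
  /-- P5 (nontriviality). -/
  nontrivial : ∃ x y, StrictPref pref (const S x) (const S y)
  /-- P6 (small-event continuity): some finite partition `p ⁻¹' {0}, …, p ⁻¹' {n - 1}` of the states
  is so fine that changing `f` or `g` to `x` on one cell does not reverse the preference. -/
  small_events : ∀ f g, StrictPref pref f g → ∀ x : C, ∃ (n : ℕ) (p : S → Fin n), ∀ i,
    StrictPref pref (glue (p ⁻¹' {i}) (const S x) f) g ∧
      StrictPref pref f (glue (p ⁻¹' {i}) (const S x) g)

namespace CausalDecisionProblem

/-- The action `a` as an act on a refinement `π : S → Ω` of the state space. -/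
def toAct {V : Type*} [Fintype V] {Val : V → Type*} {Ω : Type*}
    (D : CausalDecisionProblem V Val Ω) {S : Type*} (π : S → Ω) (a : D.Action) :
    SavageAct S D.Consequence :=
  ⟨fun s => D.outcome a (π s), ((D.finite_range_response a).image (fun x => x D.outcomeVar)).subset
    (by rintro _ ⟨s, rfl⟩; exact ⟨_, ⟨π s, rfl⟩, rfl⟩)⟩

/-- The preferences between the available actions are Savage-rational: after a refinement of the
states (each state `ω` being split into the nonempty set `π ⁻¹' {ω}`), they are the
restriction to the available actions of a preference relation between all acts that satisfies
Savage's axioms. -/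
def SavageRational.{u, v, w} {V : Type u} [Fintype V] {Val : V → Type v} {Ω : Type w}
    (D : CausalDecisionProblem V Val Ω) : Prop :=
  ∃ (S : Type w) (π : S → Ω) (pref' : SavageAct S D.Consequence → SavageAct S D.Consequence → Prop),
    Function.Surjective π ∧ SavageAxioms pref' ∧
      ∀ a b : D.Action, D.pref a b ↔ pref' (D.toAct π a) (D.toAct π b)

/-- The causal expected utility `∑ c, u(c) · (∑ g ∈ F, P_g(c | do(a)) · P_C(g))`. When all models of
`F` control the environment, only finitely many `c` contribute. -/
noncomputable def causalUtility {V : Type*} [Fintype V] {Val : V → Type*} {Ω : Type*}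
    (D : CausalDecisionProblem V Val Ω) (u : D.Consequence → ℝ) (F : Set (CausalModel V Val))
    (P_C : PMF F) (a : D.Action) : ℝ :=
  ∑' c : D.Consequence, u c *
    ∑' g : F, (g.1.doProb D.actionVar a D.outcomeVar c).toReal * (P_C g).toReal

end CausalDecisionProblem

/-! The direction from rationality to causal expected utility is Savage's representation theorem.
Betting on events with two fixed stakes `x ≻ y` is a qualitative probability that P6 makes fine
(`SavageAxioms.qualitativeProbability`). Every event can be halved
(`QualitativeProbability.exists_half`), so the space has partitions into `2 ^ n` equally probable
cells, and counting the cells that fit into an event yields a finitely additive probability `p` that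
represents the bets (`QualitativeProbability.exists_probability`). Only finitely many consequences
matter; `x` and `y` are taken to be a best and a worst one. By P6, receiving `c` on `E` and `y`
elsewhere is as good as betting on a suitable `B ⊆ E`, found by cutting `E` with finer and finer
partitions (`exists_cut`). The map `E ↦ p B` is additive by the sure-thing principle and monotone in
`p E` by P4, hence `p B = u c * p E`, which defines the utility `u`
(`SavageAxioms.exists_utility`). Replacing the consequences of an act one by one turns it into a bet
whose probability is its expected utility (`SavageAxioms.exists_expectedUtility`).

Causal models enter through the joint response of a state to all actions at once, which has finitely
many values because there are finitely many actions. For each state there is a deterministic causal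
model, whose graph has an edge from the action to every other variable, that controls the
environment with the point mass at this state as witness (`UncertainEnvironment.controls_stateModel`). A mixture
of these models over representatives of the joint responses realizes any probability of the joint
responses (`CausalDecisionProblem.exists_mixture`).

Conversely, a mixture of controlling models assigns weights to the joint responses
(`CausalDecisionProblem.exists_weights`), so that causal expected utility is expected utility for a
finitely supported probability on the states. It becomes fine enough for P6 on the refinement
`Ω × ℕ`, where each point mass is spread uniformly over a copy of `ℕ` by an ultrafilter limit of
averages (`isMean_sum_averageLim`), and expected utility for such a probability satisfies Savage's
axioms (`IsMean.savageAxioms`). -/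

/-! ### Limits of bounded sequences along an ultrafilter -/

open Filter in
/-- The limit of a real sequence along a fixed nonprincipal ultrafilter on `ℕ`. It exists for every
bounded sequence (`tendsto_ultraLim`) and is a junk value otherwise. -/
noncomputable def ultraLim (x : ℕ → ℝ) : ℝ := limUnder (hyperfilter ℕ : Filter ℕ) x

section UltraLim

open Filter Topology

theorem tendsto_ultraLim {x : ℕ → ℝ} {M : ℝ} (hx : ∀ n, |x n| ≤ M) :
    Tendsto x (hyperfilter ℕ : Filter ℕ) (𝓝 (ultraLim x)) := by
  obtain ⟨a, -, ha⟩ := (isCompact_Icc (a := -M) (b := M)).ultrafilter_le_nhds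
    ((hyperfilter ℕ).map x) (by
      simp only [Ultrafilter.coe_map, le_principal_iff, mem_map]
      exact univ_mem' fun n => abs_le.1 (hx n))
  exact tendsto_nhds_limUnder ⟨a, ha⟩

theorem ultraLim_eq_of_tendsto {x : ℕ → ℝ} {a : ℝ}
    (h : Tendsto x (hyperfilter ℕ : Filter ℕ) (𝓝 a)) : ultraLim x = a :=
  h.limUnder_eq

theorem ultraLim_eq_of_tendsto_atTop {x : ℕ → ℝ} {a : ℝ} (h : Tendsto x atTop (𝓝 a)) :
    ultraLim x = a :=
  ultraLim_eq_of_tendsto (h.mono_left Nat.hyperfilter_le_atTop)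

theorem ultraLim_add {x y : ℕ → ℝ} {M M' : ℝ} (hx : ∀ n, |x n| ≤ M) (hy : ∀ n, |y n| ≤ M') :
    ultraLim (fun n => x n + y n) = ultraLim x + ultraLim y :=
  ultraLim_eq_of_tendsto ((tendsto_ultraLim hx).add (tendsto_ultraLim hy))

theorem ultraLim_const_mul {x : ℕ → ℝ} {M : ℝ} (c : ℝ) (hx : ∀ n, |x n| ≤ M) :
    ultraLim (fun n => c * x n) = c * ultraLim x :=
  ultraLim_eq_of_tendsto ((tendsto_ultraLim hx).const_mul c)

theorem ultraLim_mono {x y : ℕ → ℝ} {M M' : ℝ} (hx : ∀ n, |x n| ≤ M) (hy : ∀ n, |y n| ≤ M')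
    (h : ∀ n, x n ≤ y n) : ultraLim x ≤ ultraLim y :=
  le_of_tendsto_of_tendsto' (tendsto_ultraLim hx) (tendsto_ultraLim hy) h

end UltraLim

/-! ### Cutting an event by finer and finer partitions -/

/-- A set between "low" and "high" subsets of `E` that differ arbitrarily little. Starting from
`∅ ⊆ E`, the cells of a fine partition are added one by one to the current low set until the result
is high; the last cell added contains the new difference. The cut is the union of the increasing
sequence of low sets so obtained. -/
theorem exists_cut {S : Type*} {E : Set S} (lo hi : Set S → Prop) (small : ℕ → Set S → Prop)
    (h_or : ∀ B ⊆ E, lo B ∨ hi B) (h_lo : lo ∅) (h_hi : hi E) (h_empty : ∀ n, small n ∅)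
    (h_small : ∀ n, ∃ (k : ℕ) (f : S → Fin k), ∀ i, ∀ H ⊆ f ⁻¹' {i}, small n H) :
    ∃ B ⊆ E, ∀ n, ∃ L U, L ⊆ B ∧ B ⊆ U ∧ U ⊆ E ∧ lo L ∧ hi U ∧ small n (U \ L) := by
  have step : ∀ n L U, L ⊆ U → U ⊆ E → lo L → hi U →
      ∃ L' U', L ⊆ L' ∧ L' ⊆ U' ∧ U' ⊆ U ∧ lo L' ∧ hi U' ∧ small n (U' \ L') := by
    intro n L U hLU hUE hL hU
    obtain ⟨k, f, hf⟩ := h_small n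
    let T : ℕ → Set S := fun j => {s | s ∈ L ∨ s ∈ U ∧ (f s : ℕ) < j}
    have hT0 : T 0 = L := by ext s; simp [T]
    have hTk : T k = U := by
      ext s
      simp only [T, Set.mem_ofPred_eq, (f s).2, and_true]
      exact ⟨fun h => h.elim (fun h => hLU h) id, Or.inr⟩
    have hTU : ∀ j, T j ⊆ U := fun j s hs => hs.elim (fun h => hLU h) fun h => h.1
    classical
    have hex : ∃ j, hi (T j) := ⟨k, by rwa [hTk]⟩
    obtain hj | ⟨j, hj⟩ : Nat.find hex = 0 ∨ ∃ j, Nat.find hex = j + 1 := by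
      cases Nat.find hex <;> simp
    · have h := Nat.find_spec hex
      rw [hj, hT0] at h
      exact ⟨L, L, le_rfl, le_rfl, hLU, hL, h, by simpa using h_empty n⟩
    · have h := Nat.find_spec hex
      have hlo : lo (T j) := (h_or _ ((hTU j).trans hUE)).resolve_right
        (Nat.find_min hex (by omega))
      rw [hj] at h
      have hjk : j < k := by
        by_contra hjk
        have : T j = U := by
          ext s
          have := (f s).2
          have h' : (f s : ℕ) < j := by omega
          simp only [T, Set.mem_ofPred_eq, h', and_true]
          exact ⟨fun h => h.elim (fun h => hLU h) id, Or.inr⟩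
        exact Nat.find_min hex (m := j) (by omega) (by rwa [this])
      refine ⟨T j, T (j + 1), fun s hs => Or.inl hs, ?_, hTU _, hlo, h, hf ⟨j, hjk⟩ _ ?_⟩
      · exact fun s hs => hs.imp id fun h => ⟨h.1, h.2.trans (Nat.lt_succ_self j)⟩
      · rintro s ⟨hs, hs'⟩
        simp only [T, Set.mem_ofPred_eq] at hs hs'
        simp only [Set.mem_preimage, Set.mem_singleton_iff, Fin.ext_iff]
        push Not at hs'
        rcases hs with hs | ⟨hs, hs1⟩
        · exact absurd hs hs'.1
        · have := hs'.2 hs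
          omega
  let Good := {q : Set S × Set S // q.1 ⊆ q.2 ∧ q.2 ⊆ E ∧ lo q.1 ∧ hi q.2}
  have step' : ∀ (n : ℕ) (q : Good), ∃ q' : Good, q.1.1 ⊆ q'.1.1 ∧ q'.1.2 ⊆ q.1.2 ∧
      small n (q'.1.2 \ q'.1.1) := by
    rintro n ⟨⟨L, U⟩, h1, h2, h3, h4⟩
    obtain ⟨L', U', a, b, c, d, e, f⟩ := step n L U h1 h2 h3 h4
    exact ⟨⟨(L', U'), b, c.trans h2, d, e⟩, a, c, f⟩
  choose next hnext using step'
  let q : ℕ → Good := fun n => Nat.rec ⟨(∅, E), Set.empty_subset _, le_rfl, h_lo, h_hi⟩ next n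
  have hmono : Monotone fun n => (q n).1.1 := monotone_nat_of_le_succ fun n => (hnext n (q n)).1
  have hanti : Antitone fun n => (q n).1.2 := antitone_nat_of_succ_le fun n => (hnext n (q n)).2.1
  have hle : ∀ m n, (q m).1.1 ⊆ (q n).1.2 := fun m n =>
    (hmono (le_max_left m n)).trans ((q (max m n)).2.1.trans (hanti (le_max_right m n)))
  refine ⟨⋃ n, (q n).1.1, Set.iUnion_subset fun n => (q n).2.1.trans (q n).2.2.1, fun n => ?_⟩
  exact ⟨(q (n + 1)).1.1, (q (n + 1)).1.2, Set.subset_iUnion (fun n => (q n).1.1) (n + 1),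
    Set.iUnion_subset fun m => hle m (n + 1), (q (n + 1)).2.2.1, (q (n + 1)).2.2.2.1,
    (q (n + 1)).2.2.2.2, (hnext n (q n)).2.2⟩

/-! ### Qualitative probability -/

/-- A fine qualitative probability on all subsets of `S`; `le A B` reads "`A` is at most as probable
as `B`". The strict relation "`A` is less probable than `B`" is written `¬ le B A`. -/
structure QualitativeProbability {S : Type*} (le : Set S → Set S → Prop) : Prop where
  total : ∀ A B, le A B ∨ le B A
  trans : ∀ A B C, le A B → le B C → le A C
  union_iff : ∀ A B C, Disjoint A C → Disjoint B C → (le (A ∪ C) (B ∪ C) ↔ le A B)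
  empty_le : ∀ A, le ∅ A
  not_univ_le_empty : ¬ le Set.univ ∅
  fine_union : ∀ A B, ¬ le B A → ∃ (n : ℕ) (f : S → Fin n), ∀ i, ¬ le B (A ∪ f ⁻¹' {i})
  fine_sdiff : ∀ A B, ¬ le B A → ∃ (n : ℕ) (f : S → Fin n), ∀ i, ¬ le (B \ f ⁻¹' {i}) A

namespace QualitativeProbability

variable {S : Type*} {le : Set S → Set S → Prop} {A B C D E : Set S}

theorem refl (h : QualitativeProbability le) (A : Set S) : le A A := (h.total A A).elim id id

theorem le_of_not_le (h : QualitativeProbability le) (hAB : ¬ le A B) : le B A :=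
  (h.total A B).resolve_left hAB

theorem mono (h : QualitativeProbability le) (hAB : A ⊆ B) : le A B := by
  have := (h.union_iff ∅ (B \ A) A (by simp) Set.disjoint_sdiff_left).2 (h.empty_le _)
  rwa [Set.empty_union, Set.sdiff_union_of_subset hAB] at this

theorem union_le_union (h : QualitativeProbability le) (hAB : le A B) (hCD : le C D)
    (hAC : Disjoint A C) (hBD : Disjoint B D) : le (A ∪ C) (B ∪ D) := by
  rw [Set.disjoint_left] at hAC hBD
  have h1 := (h.union_iff A B (C \ B) (by grind)
    (by grind)).2 hAB
  have h2 := (h.union_iff C D (B \ C) (by grind)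
    (by grind)).2 hCD
  rw [show B ∪ C \ B = C ∪ B \ C by grind] at h1
  have h3 := (h.union_iff _ _ (C ∩ B) (by grind)
    (by grind)).2 (h.trans _ _ _ h1 h2)
  rwa [show A ∪ C \ B ∪ C ∩ B = A ∪ C by grind, show D ∪ B \ C ∪ C ∩ B = B ∪ D by grind] at h3

theorem not_union_le_union (h : QualitativeProbability le) (hAB : ¬ le B A) (hCD : le C D)
    (hAC : Disjoint A C) (hBD : Disjoint B D) : ¬ le (B ∪ D) (A ∪ C) := by
  rw [Set.disjoint_left] at hAC hBD
  intro hle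
  have h2 := (h.union_iff C D (B \ C) (by grind)
    (by grind)).2 hCD
  rw [show A ∪ C = A ∪ C \ B ∪ C ∩ B by grind, show B ∪ D = D ∪ B \ C ∪ C ∩ B by grind,
    h.union_iff _ _ (C ∩ B) (by grind) (by grind)] at hle
  have h3 := h.trans _ _ _ h2 hle
  rw [show C ∪ B \ C = B ∪ C \ B by grind,
    h.union_iff _ _ _ (by grind) (by grind)] at h3
  exact hAB h3

theorem union_le_empty (h : QualitativeProbability le) (hA : le A ∅) (hB : le B ∅) :
    le (A ∪ B) ∅ := by
  have := h.union_le_union hA (h.trans _ _ _ (h.mono (A := B \ A) Set.sdiff_subset) hB)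
    Set.disjoint_sdiff_right (by simp)
  simpa using this

/-- A finite partition of a non-null event has a non-null cell. -/
theorem exists_inter_not_le_empty (h : QualitativeProbability le) (hA : ¬ le A ∅) {n : ℕ}
    (f : S → Fin n) : ∃ i, ¬ le (A ∩ f ⁻¹' {i}) ∅ := by
  by_contra! hcon
  have key : ∀ t : Finset (Fin n), le (A ∩ f ⁻¹' t) ∅ := by
    intro t
    induction t using Finset.induction_on with
    | empty => simpa using h.refl ∅
    | insert i t _ ih =>
      rw [Finset.coe_insert, Set.insert_eq, Set.preimage_union, Set.inter_union_distrib_left]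
      exact h.union_le_empty (hcon i) ih
  exact hA (by simpa using key Finset.univ)

theorem le_empty_of_le_diff (h : QualitativeProbability le) (hBA : B ⊆ A) (hle : le A (A \ B)) :
    le B ∅ := by
  by_contra hB
  have := h.not_union_le_union hB (h.refl (A \ B)) (by simp) Set.disjoint_sdiff_right
  rw [Set.empty_union, Set.union_sdiff_cancel hBA] at this
  exact this hle

/-- A non-null event contains a non-null event that is at most as probable as the rest. -/
theorem exists_subset_le_diff (h : QualitativeProbability le) (hA : ¬ le A ∅) :
    ∃ B ⊆ A, ¬ le B ∅ ∧ le B (A \ B) := by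
  obtain ⟨n, f, hf⟩ := h.fine_sdiff _ _ hA
  obtain ⟨i, hi⟩ := h.exists_inter_not_le_empty hA f
  have hi' : ¬ le (A \ f ⁻¹' {i}) ∅ := hf i
  rcases h.total (A ∩ f ⁻¹' {i}) (A \ f ⁻¹' {i}) with hle | hle
  · exact ⟨_, Set.inter_subset_left, hi, by rwa [Set.sdiff_self_inter]⟩
  · exact ⟨_, Set.sdiff_subset, hi', by rwa [Set.sdiff_sdiff_right_self]⟩

/-- There are non-null events `G n` that eventually become less probable than any given non-null
event: each is taken to be at most half of the preceding one. -/
theorem exists_seq_small (h : QualitativeProbability le) :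
    ∃ G : ℕ → Set S, (∀ n, ¬ le (G n) ∅) ∧ ∀ R, ¬ le R ∅ → ∃ n, le (G n) R := by
  have step : ∀ A : {A : Set S // ¬ le A ∅}, ∃ B : {B : Set S // ¬ le B ∅},
      B.1 ⊆ A.1 ∧ le B.1 (A.1 \ B.1) := fun A =>
    let ⟨B, h1, h2, h3⟩ := h.exists_subset_le_diff A.2
    ⟨⟨B, h2⟩, h1, h3⟩
  choose next hnext using step
  let G : ℕ → {A : Set S // ¬ le A ∅} := fun n =>
    Nat.rec ⟨Set.univ, h.not_univ_le_empty⟩ (fun _ => next) n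
  have hG : ∀ n, (G (n + 1)).1 ⊆ (G n).1 ∧ le (G (n + 1)).1 ((G n).1 \ (G (n + 1)).1) :=
    fun n => hnext (G n)
  refine ⟨fun n => (G n).1, fun n => (G n).2, fun R hR => ?_⟩
  by_contra! hcon
  obtain ⟨n, f, hf⟩ := h.fine_union _ _ hR
  have hGu : ∀ k, (G k).1 ⊆ (G 0).1 := fun k => Set.subset_univ _
  -- The disjoint events `G j \ G (j + 1)` are more probable than `R`, hence than any cell of the
  -- partition `f`, so the first `n` of them would be as probable as the whole space.
  have key : ∀ k ≤ n, le {s | (f s : ℕ) < k} ((G 0).1 \ (G k).1) := by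
    intro k
    induction k with
    | zero => intro _; simpa using h.empty_le _
    | succ k ih =>
      intro hk
      have h1 : le (f ⁻¹' {⟨k, hk⟩}) ((G k).1 \ (G (k + 1)).1) := by
        refine h.trans _ _ _ ?_ (hG k).2
        refine h.trans _ _ _ (h.le_of_not_le ?_) (h.le_of_not_le (hcon (k + 1)))
        simpa using hf ⟨k, hk⟩
      have := h.union_le_union (ih (by omega)) h1
        (by
          rw [Set.disjoint_left]
          intro s hs hs'
          simp only [Set.mem_ofPred_eq, Set.mem_preimage, Set.mem_singleton_iff,
            Fin.ext_iff] at hs hs'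
          omega)
        (by grind)
      convert! this using 1
      · ext s
        simp only [Set.mem_ofPred_eq, Set.mem_preimage, Set.mem_singleton_iff, Set.mem_union,
          Fin.ext_iff]
        omega
      · have := hGu k
        have := (hG k).1
        grind
  have h1 := key n le_rfl
  have h2 : {s | (f s : ℕ) < n} = (G 0).1 := by
    ext s
    simp only [Set.mem_ofPred_eq, (f s).2, true_iff]
    trivial
  rw [h2] at h1
  exact (G n).2 (h.le_empty_of_le_diff (hGu n) h1)

/-- If `Y` is less probable than `X`, then moving a sufficiently improbable part of `X` to `Y` does
not reverse the comparison. -/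
theorem exists_slack (h : QualitativeProbability le) {X Y : Set S} (hXY : ¬ le X Y)
    (hd : Disjoint X Y) :
    ∃ R, ¬ le R ∅ ∧ ∀ H ⊆ X, le H R → ¬ le (X \ H) (Y ∪ H) := by
  have hX : ¬ le X ∅ := fun hX => hXY (h.trans _ _ _ hX (h.empty_le _))
  have cancel : ∀ {P Q R : Set S}, le P Q → ¬ le R Q → ¬ le R P :=
    fun h1 h2 h3 => h2 (h.trans _ _ _ h3 h1)
  rw [Set.disjoint_left] at hd
  obtain ⟨n, f, hf⟩ := h.fine_union _ _ hXY
  obtain ⟨i, hi⟩ := h.exists_inter_not_le_empty hX f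
  have h1 : ¬ le X (Y ∪ X ∩ f ⁻¹' {i}) := cancel (h.mono (by grind)) (hf i)
  obtain ⟨m, g, hg⟩ := h.fine_sdiff _ _ h1
  obtain ⟨j, hj⟩ := h.exists_inter_not_le_empty hX g
  have main : ∀ R, le R (X ∩ f ⁻¹' {i}) → le R (X ∩ g ⁻¹' {j}) →
      ∀ H ⊆ X, le H R → ¬ le (X \ H) (Y ∪ H) := by
    intro R hR1 hR2 H hH hHR hle
    have h2 : le (Y ∪ H) (Y ∪ X ∩ f ⁻¹' {i}) := h.union_le_union (h.refl Y)
      (h.trans _ _ _ hHR hR1) (by grind) (by grind)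
    have h3 : ¬ le (X \ g ⁻¹' {j}) (X \ H) := fun h3 =>
      hg j (h.trans _ _ _ (h.trans _ _ _ h3 hle) h2)
    have h4 := h.not_union_le_union h3 (h.trans _ _ _ hHR hR2)
      Set.disjoint_sdiff_left (by grind)
    rw [Set.sdiff_union_of_subset hH, Set.sdiff_union_inter] at h4
    exact h4 (h.refl X)
  rcases h.total (X ∩ f ⁻¹' {i}) (X ∩ g ⁻¹' {j}) with hle | hle
  · exact ⟨_, hi, main _ (h.refl _) hle⟩
  · exact ⟨_, hj, main _ hle (h.refl _)⟩

/-- Every event can be cut into two equally probable halves. -/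
theorem exists_half (h : QualitativeProbability le) (E : Set S) :
    ∃ B ⊆ E, le B (E \ B) ∧ le (E \ B) B := by
  obtain ⟨G, hG0, hG⟩ := h.exists_seq_small
  obtain ⟨B, hBE, hB⟩ := exists_cut (E := E) (fun B => le B (E \ B)) (fun B => le (E \ B) B)
    (fun n H => le H (G n)) (fun B _ => h.total _ _) (h.empty_le _)
    (by simpa using h.empty_le _) (fun n => h.empty_le _) (fun n => by
      obtain ⟨k, f, hf⟩ := h.fine_union _ _ (hG0 n)
      refine ⟨k, f, fun i H hH => h.trans _ _ _ (h.mono hH) (h.le_of_not_le ?_)⟩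
      simpa using hf i)
  refine ⟨B, hBE, ?_, ?_⟩
  · by_contra hcon
    obtain ⟨R, hR, hslack⟩ := h.exists_slack hcon Set.disjoint_sdiff_right
    obtain ⟨n, hn⟩ := hG R hR
    obtain ⟨L, U, hLB, hBU, hUE, hL, -, hs⟩ := hB n
    refine hslack (B \ L) Set.sdiff_subset
      (h.trans _ _ _ (h.mono (Set.sdiff_subset_sdiff_left hBU)) (h.trans _ _ _ hs hn)) ?_
    rwa [Set.sdiff_sdiff_cancel_left hLB, show E \ B ∪ B \ L = E \ L by grind]
  · by_contra hcon
    obtain ⟨R, hR, hslack⟩ := h.exists_slack hcon Set.disjoint_sdiff_left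
    obtain ⟨n, hn⟩ := hG R hR
    obtain ⟨L, U, hLB, hBU, hUE, -, hU, hs⟩ := hB n
    refine hslack (U \ B) (Set.sdiff_subset_sdiff_left hUE)
      (h.trans _ _ _ (h.mono (Set.sdiff_subset_sdiff_right hLB)) (h.trans _ _ _ hs hn)) ?_
    rwa [Set.union_sdiff_cancel hBU, show (E \ B) \ (U \ B) = E \ U by grind]

theorem half_le_half (h : QualitativeProbability le) {A B A' B' : Set S} (hAB : le A B)
    (hA' : A' ⊆ A) (hB' : B' ⊆ B) (hA : le A' (A \ A')) (hB : le (B \ B') B') : le A' B' := by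
  by_contra hcon
  have h1 : le (B \ B') (A \ A') :=
    h.trans _ _ _ hB (h.trans _ _ _ (h.le_of_not_le hcon) hA)
  have h2 := h.not_union_le_union hcon h1 Set.disjoint_sdiff_right Set.disjoint_sdiff_right
  rw [Set.union_sdiff_cancel hA', Set.union_sdiff_cancel hB'] at h2
  exact h2 hAB

/-- Repeated halving gives partitions into arbitrarily many equally probable cells. -/
theorem exists_uniform_partition (h : QualitativeProbability le) (m : ℕ) :
    ∃ (N : ℕ) (f : S → ℕ), m < N ∧ (∀ s, f s < N) ∧
      ∀ i < N, ∀ j < N, le (f ⁻¹' {i}) (f ⁻¹' {j}) := by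
  induction m with
  | zero =>
    refine ⟨1, fun _ => 0, by simp, by simp, fun i hi j hj => ?_⟩
    obtain rfl : i = j := by omega
    exact h.refl _
  | succ m ih =>
    obtain ⟨N, f, hN, hfN, hf⟩ := ih
    choose half hsub hle1 hle2 using fun i => h.exists_half (f ⁻¹' {i})
    classical
    let g : S → ℕ := fun s => if s ∈ half (f s) then f s else f s + N
    have g1 : ∀ i < N, g ⁻¹' {i} = half i := by
      intro i hi
      ext s
      have := hfN s
      simp only [Set.mem_preimage, Set.mem_singleton_iff, g]
      constructor
      · intro hs
        split_ifs at hs with h1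
        · rwa [← hs]
        · omega
      · intro hs
        have : f s = i := hsub i hs
        rw [this, if_pos hs]
    have g2 : ∀ i < N, g ⁻¹' {i + N} = f ⁻¹' {i} \ half i := by
      intro i hi
      ext s
      have := hfN s
      simp only [Set.mem_preimage, Set.mem_singleton_iff, g, Set.mem_sdiff]
      constructor
      · intro hs
        split_ifs at hs with h1
        · omega
        · have : f s = i := by omega
          exact ⟨this, by rwa [← this]⟩
      · rintro ⟨rfl, hs⟩
        rw [if_neg hs]
    -- The rest of a halved cell is again a half of it.
    have hle3 : ∀ i, f ⁻¹' {i} \ (f ⁻¹' {i} \ half i) = half i := fun i =>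
      Set.sdiff_sdiff_cancel_left (hsub i)
    have key : ∀ i < N + N, ∃ j < N, g ⁻¹' {i} ⊆ f ⁻¹' {j} ∧
        le (g ⁻¹' {i}) (f ⁻¹' {j} \ g ⁻¹' {i}) ∧ le (f ⁻¹' {j} \ g ⁻¹' {i}) (g ⁻¹' {i}) := by
      intro i hi
      by_cases hiN : i < N
      · exact ⟨i, hiN, by rw [g1 i hiN]; exact ⟨hsub i, hle1 i, hle2 i⟩⟩
      · obtain ⟨j, rfl⟩ : ∃ j, i = j + N := ⟨i - N, by omega⟩
        have hj : j < N := by omega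
        refine ⟨j, hj, ?_⟩
        rw [g2 j hj, hle3]
        exact ⟨Set.sdiff_subset, hle2 j, hle1 j⟩
    refine ⟨N + N, g, by omega, fun s => ?_, fun i hi j hj => ?_⟩
    · have := hfN s
      simp only [g]
      split_ifs <;> omega
    · obtain ⟨i', hi', hi1, hi2, -⟩ := key i hi
      obtain ⟨j', hj', hj1, -, hj3⟩ := key j hj
      exact h.half_le_half (hf i' hi' j' hj') hi1 hj1 hi2 hj3

end QualitativeProbability

/-! ### Finitely additive set functions -/

/-- A nonnegative, finitely additive function on all subsets of `S`. -/
structure IsFinitelyAdditive {S : Type*} (p : Set S → ℝ) : Prop where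
  nonneg : ∀ A, 0 ≤ p A
  union : ∀ A B, Disjoint A B → p (A ∪ B) = p A + p B

namespace IsFinitelyAdditive

variable {S : Type*} {p q : Set S → ℝ} {A B E : Set S}

theorem empty (hp : IsFinitelyAdditive p) : p ∅ = 0 := by
  simpa using hp.union ∅ ∅ (by simp)

theorem add_sdiff (hp : IsFinitelyAdditive p) (h : A ⊆ B) : p A + p (B \ A) = p B := by
  rw [← hp.union _ _ Set.disjoint_sdiff_right, Set.union_sdiff_cancel h]

theorem mono (hp : IsFinitelyAdditive p) (h : A ⊆ B) : p A ≤ p B := by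
  have := hp.add_sdiff h
  have := hp.nonneg (B \ A)
  linarith

theorem inter_preimage {ι : Type*} (hp : IsFinitelyAdditive p) (A : Set S) (f : S → ι)
    (t : Finset ι) : p (A ∩ f ⁻¹' t) = ∑ i ∈ t, p (A ∩ f ⁻¹' {i}) := by
  classical
  induction t using Finset.induction_on with
  | empty => simpa using hp.empty
  | insert i t hi ih =>
    rw [Finset.coe_insert, Set.insert_eq, Set.preimage_union, Set.inter_union_distrib_left,
      Finset.sum_insert hi, ← ih]
    refine hp.union _ _ (Set.disjoint_left.2 ?_)
    rintro s ⟨-, hs⟩ ⟨-, hs'⟩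
    exact hi (by simpa [show f s = i from hs] using hs')

theorem sum_inter_preimage {ι : Type*} [Fintype ι] (hp : IsFinitelyAdditive p) (A : Set S)
    (f : S → ι) : ∑ i, p (A ∩ f ⁻¹' {i}) = p A := by
  simpa using (hp.inter_preimage A f Finset.univ).symm

end IsFinitelyAdditive

/-! ### The probability that agrees with a qualitative probability -/

namespace QualitativeProbability

variable {S : Type*} {le : Set S → Set S → Prop} {A B : Set S} {N : ℕ} {f : S → ℕ}

/-- Unions of equally many cells of a uniform partition are equally probable. -/
theorem block_le_block (h : QualitativeProbability le)
    (hf : ∀ i < N, ∀ j < N, le (f ⁻¹' {i}) (f ⁻¹' {j})) (k k' : ℕ) : ∀ l, k + l ≤ N → k' + l ≤ N →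
    le {s | k ≤ f s ∧ f s < k + l} {s | k' ≤ f s ∧ f s < k' + l} := by
  intro l
  induction l with
  | zero =>
    intro _ _
    refine h.trans _ _ _ (h.mono (B := ∅) ?_) (h.empty_le _)
    rintro s ⟨h1, h2⟩
    omega
  | succ l ih =>
    intro hk hk'
    have := h.union_le_union (ih (by omega) (by omega)) (hf (k + l) (by omega) (k' + l) (by omega))
      (by rw [Set.disjoint_left]; rintro s ⟨_, h1⟩ h2; simp at h2; omega)
      (by rw [Set.disjoint_left]; rintro s ⟨_, h1⟩ h2; simp at h2; omega)
    convert! this using 1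
    · ext s; simp; omega
    · ext s; simp; omega

theorem cell_not_le_empty (h : QualitativeProbability le) (hfN : ∀ s, f s < N)
    (hf : ∀ i < N, ∀ j < N, le (f ⁻¹' {i}) (f ⁻¹' {j})) {j : ℕ} (hj : j < N) :
    ¬ le (f ⁻¹' {j}) ∅ := by
  intro hnull
  have key : ∀ k ≤ N, le {s | f s < k} ∅ := by
    intro k
    induction k with
    | zero => intro _; simpa using h.empty_le ∅
    | succ k ih =>
      intro hk
      have := h.union_le_empty (ih (by omega)) (h.trans _ _ _ (hf k (by omega) j hj) hnull)
      convert! this using 1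
      ext s; simp; omega
  have := key N le_rfl
  rw [show {s | f s < N} = Set.univ by ext s; simpa using hfN s] at this
  exact h.not_univ_le_empty this

theorem not_initial_le_initial (h : QualitativeProbability le) (hfN : ∀ s, f s < N)
    (hf : ∀ i < N, ∀ j < N, le (f ⁻¹' {i}) (f ⁻¹' {j})) {k l : ℕ} (hkl : k < l) (hl : l ≤ N) :
    ¬ le {s | f s < l} {s | f s < k} := by
  intro hle
  refine h.cell_not_le_empty hfN hf (j := k) (by omega) (h.trans _ _ _ (h.mono ?_)
    (h.le_empty_of_le_diff (A := {s | f s < l}) (B := {s | k ≤ f s ∧ f s < l})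
      (fun s hs => hs.2) (h.trans _ _ _ hle (h.mono ?_))))
  · intro s hs
    simp only [Set.mem_preimage, Set.mem_singleton_iff] at hs
    simp only [Set.mem_ofPred_eq]
    omega
  · intro s hs
    simp only [Set.mem_ofPred_eq, Set.mem_sdiff] at hs ⊢
    omega

open Classical in
/-- The greatest number `k ≤ N` such that `A` is at least as probable as the union of the cells
`f ⁻¹' {0}, …, f ⁻¹' {k - 1}`. -/
noncomputable def cellCount (le : Set S → Set S → Prop) (f : S → ℕ) (N : ℕ) (A : Set S) : ℕ :=
  Nat.findGreatest (fun k => le {s | f s < k} A) N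

theorem cellCount_le (A : Set S) : cellCount le f N A ≤ N := by
  classical exact Nat.findGreatest_le N

theorem initial_cellCount_le (h : QualitativeProbability le) (A : Set S) :
    le {s | f s < cellCount le f N A} A := by
  classical
  exact Nat.findGreatest_spec (P := fun k => le {s | f s < k} A) (Nat.zero_le N)
    (by simpa using h.empty_le A)

theorem le_cellCount {k : ℕ} (hk : k ≤ N) (hle : le {s | f s < k} A) :
    k ≤ cellCount le f N A := by
  classical exact Nat.le_findGreatest hk hle

theorem cellCount_mono (h : QualitativeProbability le) (hAB : le A B) :
    cellCount le f N A ≤ cellCount le f N B :=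
  le_cellCount (cellCount_le A) (h.trans _ _ _ (h.initial_cellCount_le A) hAB)

theorem cellCount_univ (h : QualitativeProbability le) : cellCount le f N Set.univ = N :=
  le_antisymm (cellCount_le _) (le_cellCount le_rfl (h.mono (Set.subset_univ _)))

theorem initial_union_block (k l : ℕ) :
    {s | f s < k} ∪ {s | k ≤ f s ∧ f s < k + l} = {s | f s < k + l} := by
  ext s; simp; omega

theorem disjoint_initial_block (k l : ℕ) :
    Disjoint {s | f s < k} {s | k ≤ f s ∧ f s < k + l} := by
  rw [Set.disjoint_left]
  rintro s h1 ⟨h2, _⟩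
  simp only [Set.mem_ofPred_eq] at h1
  omega

/-- The number of cells that fit into an event is additive up to an error of one. -/
theorem cellCount_union (h : QualitativeProbability le) (hfN : ∀ s, f s < N)
    (hf : ∀ i < N, ∀ j < N, le (f ⁻¹' {i}) (f ⁻¹' {j})) (hAB : Disjoint A B) :
    cellCount le f N A + cellCount le f N B ≤ cellCount le f N (A ∪ B) ∧
      cellCount le f N (A ∪ B) ≤ cellCount le f N A + cellCount le f N B + 1 := by
  have hA := h.initial_cellCount_le (f := f) (N := N) A
  have hB := h.initial_cellCount_le (f := f) (N := N) B
  have hAN := cellCount_le (le := le) (f := f) (N := N) A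
  have hA' := fun hk => le_cellCount (le := le) (f := f) (N := N) (A := A)
    (k := cellCount le f N A + 1) hk
  have hB' := fun hk => le_cellCount (le := le) (f := f) (N := N) (A := B)
    (k := cellCount le f N B + 1) hk
  have hC := h.initial_cellCount_le (f := f) (N := N) (A ∪ B)
  have hCN := cellCount_le (le := le) (f := f) (N := N) (A ∪ B)
  set a := cellCount le f N A
  set b := cellCount le f N B
  set c := cellCount le f N (A ∪ B)
  have block : ∀ k l, k + l ≤ N → le {s | k ≤ f s ∧ f s < k + l} {s | f s < l} := fun k l hkl => by
    simpa using h.block_le_block hf k 0 l hkl (by omega)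
  have block' : ∀ k l, k + l ≤ N → le {s | f s < l} {s | k ≤ f s ∧ f s < k + l} := fun k l hkl => by
    simpa using h.block_le_block hf 0 k l (by omega) hkl
  constructor
  · have hab : a + b ≤ N := by
      by_contra hab
      have h1 : ¬ le B {s | a ≤ f s ∧ f s < a + (N - a)} := fun h1 =>
        h.not_initial_le_initial hfN hf (k := N - a) (l := b) (by omega)
          (cellCount_le B) (h.trans _ _ _ (h.trans _ _ _ hB h1) (block _ _ (by omega)))
      have h2 := h.not_union_le_union h1 hA (disjoint_initial_block _ _).symm hAB.symm
      refine h2 (h.mono fun s _ => ?_)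
      have := hfN s
      simp only [Set.mem_union, Set.mem_ofPred_eq]
      omega
    refine le_cellCount hab ?_
    rw [← initial_union_block]
    exact h.union_le_union hA (h.trans _ _ _ (block _ _ hab) hB) (disjoint_initial_block _ _) hAB
  · by_contra hc
    have h1 : ¬ le {s | f s < a + 1} A := fun h1 => by have := hA' (by omega) h1; omega
    have h2 : le B {s | a + 1 ≤ f s ∧ f s < a + 1 + (b + 1)} :=
      h.trans _ _ _ (h.le_of_not_le fun h2 => by have := hB' (by omega) h2; omega)
        (block' _ _ (by omega))
    have h3 := h.not_union_le_union h1 h2 hAB (disjoint_initial_block _ _)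
    rw [initial_union_block] at h3
    exact h3 (h.trans _ _ _ (h.mono fun s hs => by
      simp only [Set.mem_ofPred_eq] at hs ⊢; omega) hC)

open Filter Topology in
/-- A finitely additive probability that respects the order: the limit of the relative number of
cells of finer and finer uniform partitions that fit into an event. -/
theorem exists_monotone_probability (h : QualitativeProbability le) :
    ∃ p : Set S → ℝ, IsFinitelyAdditive p ∧ p Set.univ = 1 ∧ ∀ A B, le A B → p A ≤ p B := by
  choose N f hN hfN hf using h.exists_uniform_partition
  let x : Set S → ℕ → ℝ := fun A m => cellCount le (f m) (N m) A / N m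
  have hN0 : ∀ m, (0 : ℝ) < N m := fun m => by exact_mod_cast (Nat.zero_le m).trans_lt (hN m)
  have hx0 : ∀ A m, 0 ≤ x A m := fun A m => by positivity
  have hx : ∀ A m, |x A m| ≤ 1 := fun A m => by
    rw [abs_of_nonneg (hx0 A m)]
    exact div_le_one_of_le₀ (by exact_mod_cast cellCount_le A) (hN0 m).le
  refine ⟨fun A => ultraLim (x A), ⟨fun A => ?_, fun A B hAB => ?_⟩, ?_, fun A B hAB => ?_⟩
  · exact ge_of_tendsto' (tendsto_ultraLim (hx A)) (hx0 A)
  · have hlim : Tendsto (fun m => x (A ∪ B) m - (x A m + x B m)) atTop (𝓝 0) := by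
      refine squeeze_zero (g := fun m : ℕ => 1 / ((m : ℝ) + 1)) (fun m => ?_) (fun m => ?_)
        tendsto_one_div_add_atTop_nhds_zero_nat
      · have := (h.cellCount_union (hfN m) (hf m) hAB).1
        simp only [x]
        rw [← add_div, ← sub_div]
        refine div_nonneg (sub_nonneg.2 ?_) (hN0 m).le
        exact_mod_cast this
      · have := (h.cellCount_union (hfN m) (hf m) hAB).2
        simp only [x]
        rw [← add_div, ← sub_div]
        refine div_le_div₀ zero_le_one ?_ (by positivity) (by exact_mod_cast hN m)
        rw [sub_le_iff_le_add']
        exact_mod_cast this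
    have h1 := (tendsto_ultraLim (hx (A ∪ B))).sub
      ((tendsto_ultraLim (hx A)).add (tendsto_ultraLim (hx B)))
    have h2 := tendsto_nhds_unique h1 (hlim.mono_left Nat.hyperfilter_le_atTop)
    exact sub_eq_zero.1 h2
  · refine ultraLim_eq_of_tendsto ?_
    have : x Set.univ = fun _ => 1 := funext fun m => by
      simp only [x, h.cellCount_univ]
      exact div_self (hN0 m).ne'
    rw [this]
    exact tendsto_const_nhds
  · refine ultraLim_mono (hx A) (hx B) fun m => ?_
    exact div_le_div_of_nonneg_right (by exact_mod_cast h.cellCount_mono hAB) (hN0 m).le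

/-- A fine qualitative probability is represented by a finitely additive probability. -/
theorem exists_probability (h : QualitativeProbability le) :
    ∃ p : Set S → ℝ, IsFinitelyAdditive p ∧ p Set.univ = 1 ∧ ∀ A B, le A B ↔ p A ≤ p B := by
  obtain ⟨p, hp, hp1, hmono⟩ := h.exists_monotone_probability
  refine ⟨p, hp, hp1, fun A B => ⟨hmono A B, fun hle => ?_⟩⟩
  have null : ∀ R, p R = 0 → le R ∅ := by
    intro R hR
    by_contra hcon
    obtain ⟨n, f, hf⟩ := h.fine_union _ _ hcon
    have h0 : ∀ i, p (Set.univ ∩ f ⁻¹' {i}) = 0 := fun i => by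
      refine le_antisymm ?_ (hp.nonneg _)
      rw [← hR]
      exact hmono _ _ (h.le_of_not_le (by simpa using hf i))
    have := hp.sum_inter_preimage Set.univ f
    simp only [h0, Finset.sum_const_zero, hp1] at this
    exact zero_ne_one this
  by_contra hcon
  obtain ⟨n, f, hf⟩ := h.fine_union _ _ hcon
  -- Adding any cell to `B` leaves it below `A`, so every cell is almost surely contained in `B`.
  have h0 : ∀ i, p (Bᶜ ∩ f ⁻¹' {i}) = 0 := fun i => by
    refine le_antisymm ?_ (hp.nonneg _)
    have h1 := hmono _ _ (h.le_of_not_le (hf i))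
    have h2 := hp.mono (A := B ∪ Bᶜ ∩ f ⁻¹' {i}) (B := B ∪ f ⁻¹' {i})
      (Set.union_subset_union_right _ Set.inter_subset_right)
    rw [hp.union _ _ (Set.disjoint_left.2 fun s hs hs' => hs'.1 hs)] at h2
    linarith
  have h1 := hp.sum_inter_preimage Bᶜ f
  simp only [h0, Finset.sum_const_zero] at h1
  have h2 : le (B ∪ Bᶜ) (B ∪ ∅) :=
    h.union_le_union (h.refl B) (null _ h1.symm) disjoint_compl_right (by simp)
  rw [Set.union_compl_self, Set.union_empty] at h2
  exact hcon (h.trans _ _ _ (h.mono (Set.subset_univ A)) h2)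

theorem exists_partition_eq_div (h : QualitativeProbability le) {p : Set S → ℝ}
    (hp : IsFinitelyAdditive p) (hp1 : p Set.univ = 1) (hle : ∀ A B, le A B ↔ p A ≤ p B) (m : ℕ) :
    ∃ (N : ℕ) (f : S → Fin N), m < N ∧ ∀ i, p (f ⁻¹' {i}) = 1 / N := by
  obtain ⟨N, f, hN, hfN, hf⟩ := h.exists_uniform_partition m
  refine ⟨N, fun s => ⟨f s, hfN s⟩, hN, fun i => ?_⟩
  have hcell : ∀ j : Fin N, (fun s => (⟨f s, hfN s⟩ : Fin N)) ⁻¹' {j} = f ⁻¹' {(j : ℕ)} :=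
    fun j => by ext s; simp [Fin.ext_iff]
  have h1 := hp.sum_inter_preimage Set.univ (fun s => (⟨f s, hfN s⟩ : Fin N))
  have h2 : ∀ j : Fin N, p (f ⁻¹' {(j : ℕ)}) = p (f ⁻¹' {(i : ℕ)}) := fun j =>
    le_antisymm ((hle _ _).1 (hf _ j.2 _ i.2)) ((hle _ _).1 (hf _ i.2 _ j.2))
  simp only [Set.univ_inter, hcell, h2, Finset.sum_const, Finset.card_univ, Fintype.card_fin,
    nsmul_eq_mul, hp1] at h1
  have : (N : ℝ) ≠ 0 := by
    have : 0 < N := by omega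
    positivity
  rw [hcell]
  field_simp
  linarith

end QualitativeProbability

/-! ### Uniformly divisible probabilities -/

/-- A finitely additive probability for which the space has partitions into arbitrarily many equally
probable cells. -/
structure IsDivisibleProbability {S : Type*} (p : Set S → ℝ) : Prop extends
    IsFinitelyAdditive p where
  univ : p Set.univ = 1
  exists_partition : ∀ m : ℕ, ∃ (N : ℕ) (f : S → Fin N), m < N ∧ ∀ i, p (f ⁻¹' {i}) = 1 / N

namespace IsDivisibleProbability

variable {S : Type*} {p : Set S → ℝ}

theorem exists_partition_le (hp : IsDivisibleProbability p) (n : ℕ) :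
    ∃ (k : ℕ) (f : S → Fin k), ∀ i, ∀ H ⊆ f ⁻¹' {i}, p H ≤ 1 / ((n : ℝ) + 1) := by
  obtain ⟨N, f, hN, hf⟩ := hp.exists_partition n
  refine ⟨N, f, fun i H hH => (hp.mono hH).trans ?_⟩
  rw [hf i]
  exact one_div_le_one_div_of_le (by positivity) (by exact_mod_cast hN)

/-- A finitely additive function that is monotone in a divisible probability is a multiple of it. -/
theorem eq_mul_of_monotone (hp : IsDivisibleProbability p) {q : Set S → ℝ}
    (hq : IsFinitelyAdditive q) (hmono : ∀ A B, p A ≤ p B → q A ≤ q B) (A : Set S) :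
    q A = q Set.univ * p A := by
  have hQ := hq.nonneg Set.univ
  refine eq_of_abs_sub_le_all fun ε hε => ?_
  obtain ⟨m, hm⟩ := exists_nat_gt (q Set.univ / ε)
  obtain ⟨N, f, hN, hf⟩ := hp.exists_partition m
  have hN0 : (0 : ℝ) < N := by exact_mod_cast (Nat.zero_le m).trans_lt hN
  have hqf : ∀ i, q (f ⁻¹' {i}) = q Set.univ / N := fun i => by
    have h1 := hq.sum_inter_preimage Set.univ f
    have h2 : ∀ j, q (f ⁻¹' {j}) = q (f ⁻¹' {i}) := fun j =>
      le_antisymm (hmono _ _ (by rw [hf, hf])) (hmono _ _ (by rw [hf, hf]))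
    simp only [Set.univ_inter, h2, Finset.sum_const, Finset.card_univ, Fintype.card_fin,
      nsmul_eq_mul] at h1
    field_simp
    linarith
  have hpt : ∀ t : Finset (Fin N), p (f ⁻¹' t) = t.card / N := fun t => by
    simpa [hf, div_eq_mul_inv] using hp.inter_preimage Set.univ f t
  have hqt : ∀ t : Finset (Fin N), q (f ⁻¹' t) = t.card * (q Set.univ / N) := fun t => by
    simpa [hqf] using hq.inter_preimage Set.univ f t
  have hsmall : q Set.univ / N < ε := by
    rw [div_lt_iff₀ hN0]
    have : (m : ℝ) < N := by exact_mod_cast hN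
    rw [div_lt_iff₀ hε] at hm
    nlinarith
  have hA1 : p A ≤ 1 := hp.univ ▸ hp.mono (Set.subset_univ A)
  have hA0 := hp.nonneg A
  -- Compare `A` with unions of `⌊p A * N⌋` and of `⌊p A * N⌋ + 1` cells.
  obtain ⟨k, hk⟩ : ∃ k, k = ⌊p A * N⌋₊ := ⟨_, rfl⟩
  have hk1 : (k : ℝ) ≤ p A * N := hk ▸ Nat.floor_le (by positivity)
  have hk2 : p A * N < k + 1 := hk ▸ Nat.lt_floor_add_one _
  have hkN : k ≤ N := by
    have : (k : ℝ) ≤ N := by nlinarith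
    exact_mod_cast this
  have exists_card : ∀ l ≤ N, ∃ t : Finset (Fin N), t.card = l := fun l hl => by
    obtain ⟨t, -, ht⟩ := Finset.exists_subset_card_eq (s := (Finset.univ : Finset (Fin N)))
      (n := l) (by simpa using hl)
    exact ⟨t, ht⟩
  have hlow : k * (q Set.univ / N) ≤ q A := by
    obtain ⟨t, ht⟩ := exists_card k hkN
    rw [← ht, ← hqt]
    refine hmono _ _ ?_
    rw [hpt, ht]
    exact (div_le_iff₀ hN0).2 hk1
  have hupp : q A ≤ (k + 1) * (q Set.univ / N) := by
    rcases hkN.lt_or_eq with hlt | heq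
    · obtain ⟨t, ht⟩ := exists_card (k + 1) hlt
      have : ((k : ℝ) + 1) = t.card := by rw [ht]; push_cast; rfl
      rw [this, ← hqt]
      refine hmono _ _ ?_
      rw [hpt, ← this]
      exact (le_div_iff₀ hN0).2 hk2.le
    · have h1 := hq.mono (Set.subset_univ A)
      have h2 : (k : ℝ) * (q Set.univ / N) = q Set.univ := by
        rw [heq]
        field_simp
      have h3 : 0 ≤ q Set.univ / N := by positivity
      linarith
  have h1 : q Set.univ * p A = p A * N * (q Set.univ / N) := by field_simp
  have h2 : 0 ≤ q Set.univ / N := by positivity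
  rw [abs_le]
  constructor <;> nlinarith

end IsDivisibleProbability

/-! ### Savage's representation theorem for finitely many consequences -/

namespace SavageAct

variable {S C : Type*}

open Classical in
theorem glue_apply (E : Set S) (f h : SavageAct S C) (s : S) :
    (glue E f h).1 s = if s ∈ E then f.1 s else h.1 s := rfl

@[simp]
theorem const_apply (x : C) (s : S) : (const S x).1 s = x := rfl

@[ext]
theorem ext {f g : SavageAct S C} (h : ∀ s, f.1 s = g.1 s) : f = g := Subtype.ext (funext h)

/-- The bet that pays `x` on `A` and `y` off `A`. -/
noncomputable def bet (x y : C) (A : Set S) : SavageAct S C := glue A (const S x) (const S y)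

open Classical in
theorem bet_apply (x y : C) (A : Set S) (s : S) : (bet x y A).1 s = if s ∈ A then x else y := rfl

theorem bet_univ (x y : C) : bet x y (Set.univ : Set S) = const S x := by
  ext s; simp [bet_apply]

theorem bet_empty (x y : C) : bet x y (∅ : Set S) = const S y := by
  ext s; simp [bet_apply]

theorem bet_self (x : C) (A : Set S) : bet x x A = const S x := by
  ext s; simp [bet_apply]

theorem glue_const_bet_left (x y : C) (A B : Set S) :
    glue A (const S x) (bet x y B) = bet x y (B ∪ A) := by
  ext s
  by_cases hA : s ∈ A <;> by_cases hB : s ∈ B <;> simp [bet_apply, glue_apply, hA, hB]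

theorem glue_const_bet_right (x y : C) (A B : Set S) :
    glue A (const S y) (bet x y B) = bet x y (B \ A) := by
  ext s
  by_cases hA : s ∈ A <;> by_cases hB : s ∈ B <;> simp [bet_apply, glue_apply, hA, hB]

theorem glue_bet_const_of_subset (x y : C) {A E : Set S} (h : A ⊆ E) :
    glue E (bet x y A) (const S y) = bet x y A := by
  ext s
  by_cases hA : s ∈ A
  · simp [bet_apply, glue_apply, hA, h hA]
  · simp [bet_apply, glue_apply, hA]

end SavageAct

section Preorder

variable {α : Type*} {pref : α → α → Prop}

theorem exists_best (htotal : ∀ f g, pref f g ∨ pref g f)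
    (htrans : ∀ f g h, pref f g → pref g h → pref f h) {s : Finset α} (hs : s.Nonempty) :
    ∃ m ∈ s, ∀ x ∈ s, pref m x := by
  have hrefl : ∀ x, pref x x := fun x => (htotal x x).elim id id
  induction hs using Finset.Nonempty.cons_induction with
  | singleton a => exact ⟨a, by simp, by simpa using hrefl a⟩
  | cons a s ha hs ih =>
    obtain ⟨m, hm, hmax⟩ := ih
    rcases htotal a m with h | h
    · exact ⟨a, by simp, by simpa using ⟨hrefl a, fun x hx => htrans _ _ _ h (hmax x hx)⟩⟩
    · exact ⟨m, by simp [hm], by simpa using ⟨h, hmax⟩⟩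

end Preorder

namespace SavageAxioms

open SavageAct

variable {S C : Type*} {pref : SavageAct S C → SavageAct S C → Prop}

theorem refl (ax : SavageAxioms pref) (f : SavageAct S C) : pref f f := (ax.total f f).elim id id

theorem indiff_trans (ax : SavageAxioms pref) {f g h : SavageAct S C} (h1 : Indiff pref f g)
    (h2 : Indiff pref g h) : Indiff pref f h :=
  ⟨ax.trans _ _ _ h1.1 h2.1, ax.trans _ _ _ h2.2 h1.2⟩

theorem strictPref_of_not (ax : SavageAxioms pref) {f g : SavageAct S C} (h : ¬ pref g f) :
    StrictPref pref f g :=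
  ⟨(ax.total f g).resolve_right h, h⟩

theorem glue_indiff (ax : SavageAxioms pref) {E : Set S} {f g h : SavageAct S C}
    (h1 : Indiff pref (glue E f h) (glue E g h)) (h' : SavageAct S C) :
    Indiff pref (glue E f h') (glue E g h') :=
  ⟨(ax.sure_thing E f g h h').1 h1.1, (ax.sure_thing E g f h h').1 h1.2⟩

theorem glue_const_mono (ax : SavageAxioms pref) {x y : C} (hxy : pref (const S x) (const S y))
    (E : Set S) (h : SavageAct S C) : pref (glue E (const S x) h) (glue E (const S y) h) := by
  by_cases hE : NullEvent pref E
  · exact (hE _ _ _).1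
  · exact (ax.state_independence E hE x y h).1 hxy

/-- The willingness to bet on events with the stakes `x ≻ y` is a fine qualitative probability. -/
theorem qualitativeProbability (ax : SavageAxioms pref) {x y : C}
    (hxy : StrictPref pref (const S x) (const S y)) :
    QualitativeProbability fun A B => pref (bet x y B) (bet x y A) where
  total _ _ := ax.total _ _
  trans _ _ _ h1 h2 := ax.trans _ _ _ h2 h1
  union_iff A B D hA hB := by
    have h1 : ∀ A : Set S, bet x y (A ∪ D) = glue Dᶜ (bet x y A) (const S x) := fun A => by
      ext s
      by_cases hs : s ∈ D <;> by_cases hA : s ∈ A <;> simp [bet_apply, glue_apply, hs, hA]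
    have h2 : ∀ A : Set S, Disjoint A D → bet x y A = glue Dᶜ (bet x y A) (const S y) :=
      fun A hA => (glue_bet_const_of_subset x y hA.subset_compl_right).symm
    rw [h1, h1]
    conv_rhs => rw [h2 A hA, h2 B hB]
    exact ax.sure_thing _ _ _ _ _
  empty_le A := by
    rw [bet_empty, ← bet_self y A]
    exact ax.glue_const_mono hxy.1 A _
  not_univ_le_empty := by
    rw [bet_univ, bet_empty]
    exact hxy.2
  fine_union A B h := by
    obtain ⟨n, f, hf⟩ := ax.small_events _ _ (ax.strictPref_of_not h) x
    refine ⟨n, f, fun i => ?_⟩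
    rw [← glue_const_bet_left]
    exact (hf i).2.2
  fine_sdiff A B h := by
    obtain ⟨n, f, hf⟩ := ax.small_events _ _ (ax.strictPref_of_not h) y
    refine ⟨n, f, fun i => ?_⟩
    rw [← glue_const_bet_right]
    exact (hf i).1.2

/-- Acts that are replaceable by bets on two disjoint events can be replaced by bets jointly. -/
theorem indiff_bet_union (ax : SavageAxioms pref) {x y : C} {E F A B : Set S}
    {f g : SavageAct S C} (hEF : Disjoint E F) (hA : A ⊆ E) (hB : B ⊆ F)
    (hf : Indiff pref (glue E f (const S y)) (bet x y A))
    (hg : Indiff pref (glue F g (const S y)) (bet x y B)) :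
    Indiff pref (glue E f (glue F g (const S y))) (bet x y (A ∪ B)) := by
  rw [Set.disjoint_left] at hEF
  rw [← glue_bet_const_of_subset x y hA] at hf
  rw [← glue_bet_const_of_subset x y hB] at hg
  have h1 := ax.glue_indiff hf (glue F g (const S y))
  have h2 := ax.glue_indiff hg (bet x y A)
  have h3 : glue E (bet x y A) (glue F g (const S y)) = glue F g (bet x y A) := by
    ext s
    by_cases hE : s ∈ E
    · simp [glue_apply, hE, hEF hE]
    · have : s ∉ A := fun h => hE (hA h)
      simp [glue_apply, bet_apply, hE, this]
  have h4 : glue F (bet x y B) (bet x y A) = bet x y (A ∪ B) := by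
    ext s
    by_cases hF : s ∈ F
    · have : s ∉ A := fun h => hEF (hA h) hF
      by_cases hB : s ∈ B <;> simp [glue_apply, bet_apply, hF, this, hB]
    · have : s ∉ B := fun h => hF (hB h)
      by_cases hA : s ∈ A <;> simp [glue_apply, bet_apply, hF, this, hA]
  rw [h3] at h1
  rw [h4] at h2
  exact ax.indiff_trans h1 h2

section Agreeing

variable {x y : C} {p : Set S → ℝ}

/-- A consequence between `y` and `x` on an event `E` is as good as `x` on a suitable part of `E`
and `y` on the rest. -/
theorem exists_indiff_bet (ax : SavageAxioms pref) (hp : IsDivisibleProbability p)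
    (hpref : ∀ A B, pref (bet x y B) (bet x y A) ↔ p A ≤ p B) {c : C}
    (hxc : pref (const S x) (const S c)) (hcy : pref (const S c) (const S y)) (E : Set S) :
    ∃ B ⊆ E, Indiff pref (bet c y E) (bet x y B) := by
  have hE : pref (bet x y E) (bet c y E) := ax.glue_const_mono hxc E _
  have h0 : pref (bet c y E) (bet x y ∅) := by
    rw [bet_empty, ← bet_self y E]
    exact ax.glue_const_mono hcy E _
  obtain ⟨B, hBE, hB⟩ := exists_cut (E := E) (fun B => pref (bet c y E) (bet x y B))
    (fun B => pref (bet x y B) (bet c y E)) (fun n H => p H ≤ 1 / ((n : ℝ) + 1))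
    (fun B _ => ax.total _ _) h0 hE (fun n => by rw [hp.empty]; positivity) hp.exists_partition_le
  have exists_cell : ∀ {n : ℕ} (f : S → Fin n) (A : Set S), p A ≠ 0 →
      ∃ i, 0 < p (A ∩ f ⁻¹' {i}) := by
    intro n f A hA
    by_contra! hcon
    refine hA ?_
    rw [← hp.sum_inter_preimage A f]
    exact Finset.sum_eq_zero fun i _ => le_antisymm (hcon i) (hp.nonneg _)
  refine ⟨B, hBE, ?_, ?_⟩
  · by_contra hcon
    obtain ⟨n, f, hf⟩ := ax.small_events _ _ (ax.strictPref_of_not hcon) y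
    have hpB : p B ≠ 0 := fun hpB =>
      hcon (ax.trans _ _ _ h0 ((hpref _ _).2 (by rw [hpB, hp.empty])))
    obtain ⟨i, hi⟩ := exists_cell f B hpB
    obtain ⟨m, hm⟩ := exists_nat_one_div_lt hi
    obtain ⟨L, U, hLB, hBU, hUE, hL, -, hs⟩ := hB m
    refine (hf i).1.2 (ax.trans _ _ _ hL ?_)
    rw [glue_const_bet_right, hpref]
    have h1 := hp.add_sdiff hLB
    have h2 := hp.mono (Set.sdiff_subset_sdiff_left (t := L) hBU)
    have h3 := hp.add_sdiff (Set.inter_subset_left (s := B) (t := f ⁻¹' {i}))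
    rw [Set.sdiff_self_inter] at h3
    linarith
  · by_contra hcon
    obtain ⟨n, f, hf⟩ := ax.small_events _ _ (ax.strictPref_of_not hcon) x
    have h1 := hp.add_sdiff hBE
    have hpB : p (E \ B) ≠ 0 := fun hpB =>
      hcon (ax.trans _ _ _ ((hpref _ _).2 (by linarith)) hE)
    obtain ⟨i, hi⟩ := exists_cell f _ hpB
    obtain ⟨m, hm⟩ := exists_nat_one_div_lt hi
    obtain ⟨L, U, hLB, hBU, hUE, -, hU, hs⟩ := hB m
    refine (hf i).2.2 (ax.trans _ _ _ ?_ hU)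
    rw [glue_const_bet_left, hpref]
    have h2 := hp.add_sdiff hBU
    have h3 := hp.mono (Set.sdiff_subset_sdiff_right (s := U) hLB)
    have h4 := hp.union B (E \ B ∩ f ⁻¹' {i}) (Set.disjoint_left.2 fun s hs hs' => hs'.1.2 hs)
    have h5 := hp.mono (A := B ∪ E \ B ∩ f ⁻¹' {i}) (B := B ∪ f ⁻¹' {i})
      (Set.union_subset_union_right _ Set.inter_subset_right)
    linarith

/-- The part of `E` in `exists_indiff_bet` takes up the same proportion of every event `E`: by the
sure-thing principle its probability is additive in `E`, by P4 it is monotone in `p E`. The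
proportion is the utility of `c` on the scale where `x` has utility `1` and `y` has utility `0`. -/
theorem exists_utility (ax : SavageAxioms pref) (hp : IsDivisibleProbability p)
    (hpref : ∀ A B, pref (bet x y B) (bet x y A) ↔ p A ≤ p B)
    (hxy : StrictPref pref (const S x) (const S y)) {c : C}
    (hxc : pref (const S x) (const S c)) (hcy : pref (const S c) (const S y)) :
    ∃ u : ℝ, ∀ E, ∃ B ⊆ E, p B = u * p E ∧ Indiff pref (bet c y E) (bet x y B) := by
  choose B hBE hB using ax.exists_indiff_bet hp hpref hxc hcy
  have hadd : IsFinitelyAdditive fun E => p (B E) := by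
    refine ⟨fun E => hp.nonneg _, fun E F hEF => ?_⟩
    have h1 := ax.indiff_bet_union hEF (hBE E) (hBE F) (hB E) (hB F)
    have h2 : glue E (const S c) (glue F (const S c) (const S y)) = bet c y (E ∪ F) := by
      ext s
      by_cases hE : s ∈ E <;> by_cases hF : s ∈ F <;> simp [glue_apply, bet_apply, hE, hF]
    rw [h2] at h1
    have h3 := hB (E ∪ F)
    rw [← hp.union _ _ (hEF.mono (hBE E) (hBE F))]
    exact le_antisymm ((hpref _ _).1 (ax.trans _ _ _ h1.2 h3.1))
      ((hpref _ _).1 (ax.trans _ _ _ h3.2 h1.1))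
  have hmono : ∀ E F, p E ≤ p F → p (B E) ≤ p (B F) := by
    intro E F hEF
    refine (hpref _ _).1 (ax.trans _ _ _ (hB F).2 (ax.trans _ _ _ ?_ (hB E).1))
    by_cases hyc : pref (const S y) (const S c)
    · have h1 := ax.glue_const_mono hcy F (const S y)
      have h2 := ax.glue_const_mono hyc E (const S y)
      change pref _ (bet y y F) at h1
      change pref (bet y y E) _ at h2
      rw [bet_self] at h1 h2
      exact ax.trans _ _ _ h1 h2
    · exact (ax.comparative_probability F E x y c y hxy ⟨hcy, hyc⟩).1 ((hpref _ _).2 hEF)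
  exact ⟨p (B Set.univ), fun E => ⟨B E, hBE E, hp.eq_mul_of_monotone hadd hmono E, hB E⟩⟩

end Agreeing

/-- Savage's representation theorem for the acts with consequences in a finite set. The given set
`K` is enlarged to a set `K'` with two consequences that are not equally good: a best element `x`
and a worst element `y` of `K'` are the stakes of the bets that every act is reduced to. -/
theorem exists_expectedUtility (ax : SavageAxioms pref) (K : Finset C) :
    ∃ (K' : Finset C) (p : Set S → ℝ) (u : C → ℝ), K ⊆ K' ∧ IsFinitelyAdditive p ∧
      p Set.univ = 1 ∧ (∃ c c', u c ≠ u c') ∧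
      ∀ f g : SavageAct S C, (∀ s, f.1 s ∈ K') → (∀ s, g.1 s ∈ K') →
        (pref f g ↔ ∑ c ∈ K', u c * p (g.1 ⁻¹' {c}) ≤ ∑ c ∈ K', u c * p (f.1 ⁻¹' {c})) := by
  classical
  obtain ⟨a, b, hab⟩ := ax.nontrivial
  let K' : Finset C := insert a (insert b K)
  have hne : K'.Nonempty := ⟨a, by simp [K']⟩
  obtain ⟨x, -, hx⟩ := exists_best (pref := fun c c' => pref (const S c) (const S c'))
    (fun _ _ => ax.total _ _) (fun _ _ _ => ax.trans _ _ _) hne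
  obtain ⟨y, -, hy⟩ := exists_best (pref := fun c c' => pref (const S c') (const S c))
    (fun _ _ => ax.total _ _) (fun _ _ _ h1 h2 => ax.trans _ _ _ h2 h1) hne
  have hxy : StrictPref pref (const S x) (const S y) := by
    refine ax.strictPref_of_not fun hyx => hab.2 ?_
    exact ax.trans _ _ _ (hy b (by simp [K'])) (ax.trans _ _ _ hyx (hx a (by simp [K'])))
  have hqp := ax.qualitativeProbability hxy
  obtain ⟨p, hp, hp1, hpref⟩ := hqp.exists_probability
  have hdiv : IsDivisibleProbability p :=
    { toIsFinitelyAdditive := hp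
      univ := hp1
      exists_partition := hqp.exists_partition_eq_div hp hp1 hpref }
  have hu : ∀ c, ∃ u : ℝ, pref (const S x) (const S c) → pref (const S c) (const S y) →
      ∀ E, ∃ B ⊆ E, p B = u * p E ∧ Indiff pref (bet c y E) (bet x y B) := by
    intro c
    by_cases h : pref (const S x) (const S c) ∧ pref (const S c) (const S y)
    · exact (ax.exists_utility hdiv hpref hxy h.1 h.2).imp fun u hu _ _ => hu
    · exact ⟨0, fun h1 h2 => absurd ⟨h1, h2⟩ h⟩
  choose u hu using hu
  refine ⟨K', p, u, fun c hc => by simp [K', hc], hp, hp1, ⟨x, y, ?_⟩, ?_⟩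
  · obtain ⟨B, -, hB, hB'⟩ := hu x (ax.refl _) hxy.1 Set.univ
    obtain ⟨B₀, -, hB₀, hB₀'⟩ := hu y hxy.1 (ax.refl _) Set.univ
    have h1 : p Set.univ ≤ p B := (hpref _ _).1 hB'.2
    rw [bet_self, ← bet_empty x y] at hB₀'
    have h2 : p B₀ ≤ p ∅ := (hpref _ _).1 hB₀'.1
    rw [hp.empty] at h2
    intro heq
    rw [hp1] at *
    linarith
  · have key : ∀ f : SavageAct S C, ∀ T ⊆ K', ∃ B ⊆ f.1 ⁻¹' (T : Set C),
        p B = ∑ c ∈ T, u c * p (f.1 ⁻¹' {c}) ∧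
          Indiff pref (glue (f.1 ⁻¹' (T : Set C)) f (const S y)) (bet x y B) := by
      intro f T
      induction T using Finset.induction_on with
      | empty =>
        intro _
        refine ⟨∅, Set.empty_subset _, by simpa using hp.empty, ?_⟩
        rw [bet_empty, show glue (f.1 ⁻¹' ((∅ : Finset C) : Set C)) f (const S y) = const S y by
          ext s; simp [glue_apply]]
        exact ⟨ax.refl _, ax.refl _⟩
      | insert c T hc ih =>
        intro hT
        obtain ⟨hcK, hTK⟩ := Finset.insert_subset_iff.1 hT
        obtain ⟨B, hBT, hpB, hB⟩ := ih hTK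
        obtain ⟨B', hBc, hpB', hB'⟩ := hu c (hx c hcK) (hy c hcK) (f.1 ⁻¹' {c})
        have hd : Disjoint (f.1 ⁻¹' (T : Set C)) (f.1 ⁻¹' {c}) := by
          rw [Set.disjoint_left]
          intro s hs hs'
          exact hc (by simpa [show f.1 s = c from hs'] using hs)
        refine ⟨B ∪ B', ?_, ?_, ?_⟩
        · rw [Finset.coe_insert, Set.insert_eq, Set.preimage_union, Set.union_comm]
          exact Set.union_subset_union hBc hBT
        · rw [hp.union _ _ (hd.mono hBT hBc), Finset.sum_insert hc, hpB, hpB']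
          ring
        · have h1 := ax.indiff_bet_union hd hBT hBc hB hB'
          convert! h1 using 1
          ext s
          by_cases hs : f.1 s = c
          · simp [glue_apply, hs]
          · simp [glue_apply, hs]
    have key' : ∀ f : SavageAct S C, (∀ s, f.1 s ∈ K') → ∃ B,
        p B = ∑ c ∈ K', u c * p (f.1 ⁻¹' {c}) ∧ Indiff pref f (bet x y B) := by
      intro f hf
      obtain ⟨B, -, hpB, hB⟩ := key f K' subset_rfl
      refine ⟨B, hpB, ?_⟩
      convert! hB using 1
      ext s
      simp [glue_apply, hf s]
    intro f g hf hg
    obtain ⟨A, hpA, hA⟩ := key' f hf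
    obtain ⟨B, hpB, hB⟩ := key' g hg
    rw [← hpA, ← hpB, ← hpref]
    exact ⟨fun h => ax.trans _ _ _ hA.2 (ax.trans _ _ _ h hB.1),
      fun h => ax.trans _ _ _ hA.1 (ax.trans _ _ _ h hB.2)⟩

end SavageAxioms

/-! ### Preferences that maximize expected utility satisfy Savage's axioms -/

/-- A function with bounded values. -/
def IsBoundedFun {S : Type*} (φ : S → ℝ) : Prop := ∃ M, ∀ s, |φ s| ≤ M

/-- Integration of bounded functions with respect to a finitely additive probability that is defined
on all subsets of `S` and has partitions into cells of arbitrarily small probability. -/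
structure IsMean {S : Type*} (I : (S → ℝ) → ℝ) : Prop where
  add : ∀ φ ψ, IsBoundedFun φ → IsBoundedFun ψ → I (fun s => φ s + ψ s) = I φ + I ψ
  const_mul : ∀ (c : ℝ) φ, IsBoundedFun φ → I (fun s => c * φ s) = c * I φ
  mono : ∀ φ ψ, IsBoundedFun φ → IsBoundedFun ψ → (∀ s, φ s ≤ ψ s) → I φ ≤ I ψ
  one : I (fun _ => 1) = 1
  exists_partition : ∀ n : ℕ, ∃ (k : ℕ) (f : S → Fin k), ∀ i,
    I ((f ⁻¹' {i}).indicator fun _ => 1) ≤ 1 / ((n : ℝ) + 1)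

theorem IsBoundedFun.indicator {S : Type*} {φ : S → ℝ} (hφ : IsBoundedFun φ) (E : Set S) :
    IsBoundedFun (E.indicator φ) := by
  obtain ⟨M, hM⟩ := hφ
  refine ⟨M, fun s => ?_⟩
  by_cases hs : s ∈ E
  · simpa [hs] using hM s
  · simpa [hs] using (abs_nonneg _).trans (hM s)

theorem isBoundedFun_const {S : Type*} (c : ℝ) : IsBoundedFun fun _ : S => c :=
  ⟨|c|, fun _ => le_rfl⟩

namespace SavageAct

variable {S C : Type*}

theorem isBoundedFun_utility (u : C → ℝ) (f : SavageAct S C) : IsBoundedFun fun s => u (f.1 s) := by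
  obtain ⟨M, hM⟩ := ((f.2.image fun c => |u c|).bddAbove)
  exact ⟨M, fun s => hM ⟨f.1 s, ⟨s, rfl⟩, rfl⟩⟩

end SavageAct

namespace IsMean

open SavageAct

variable {S C : Type*} {I : (S → ℝ) → ℝ}

theorem glue (hI : IsMean I) (u : C → ℝ) (E : Set S) (f h : SavageAct S C) :
    I (fun s => u ((glue E f h).1 s)) =
      I (E.indicator fun s => u (f.1 s)) + I (Eᶜ.indicator fun s => u (h.1 s)) := by
  rw [← hI.add _ _ ((isBoundedFun_utility u f).indicator E)
    ((isBoundedFun_utility u h).indicator _)]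
  congr 1
  ext s
  by_cases hs : s ∈ E <;> simp [glue_apply, hs]

theorem indicator_const (hI : IsMean I) (E : Set S) (c : ℝ) :
    I (E.indicator fun _ => c) = c * I (E.indicator fun _ => 1) := by
  rw [← hI.const_mul c _ ((isBoundedFun_const 1).indicator E)]
  congr 1
  ext s
  by_cases hs : s ∈ E <;> simp [hs]

theorem const (hI : IsMean I) (c : ℝ) : I (fun _ => c) = c := by
  simpa [hI.one] using hI.indicator_const Set.univ c

theorem indicator_nonneg (hI : IsMean I) (E : Set S) : 0 ≤ I (E.indicator fun _ => 1) := by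
  rw [← hI.const 0]
  refine hI.mono _ _ (isBoundedFun_const 0) ((isBoundedFun_const 1).indicator E) fun s => ?_
  exact Set.indicator_nonneg (fun _ _ => zero_le_one) s

theorem abs_indicator_le (hI : IsMean I) (E : Set S) {φ : S → ℝ} {M : ℝ} (hM : ∀ s, |φ s| ≤ M) :
    |I (E.indicator φ)| ≤ M * I (E.indicator fun _ => 1) := by
  have hφ : IsBoundedFun (E.indicator φ) := IsBoundedFun.indicator ⟨M, hM⟩ E
  have h1 := hI.mono _ _ hφ ((isBoundedFun_const M).indicator E) fun s =>
    Set.indicator_le_indicator (abs_le.1 (hM s)).2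
  have h2 := hI.mono _ _ ((isBoundedFun_const (-M)).indicator E) hφ fun s =>
    Set.indicator_le_indicator (abs_le.1 (hM s)).1
  rw [hI.indicator_const E] at h1 h2
  rw [abs_le]
  constructor <;> linarith

theorem indicator_compl (hI : IsMean I) (E : Set S) :
    I (Eᶜ.indicator fun _ => 1) = 1 - I (E.indicator fun _ => 1) := by
  have h1 := hI.add _ _ ((isBoundedFun_const 1).indicator E) ((isBoundedFun_const 1).indicator Eᶜ)
  have h2 : (fun s => E.indicator (fun _ => (1 : ℝ)) s + Eᶜ.indicator (fun _ => 1) s) =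
      fun _ => 1 := by
    ext s
    by_cases hs : s ∈ E <;> simp [hs]
  rw [h2, hI.one] at h1
  linarith

theorem bet (hI : IsMean I) (u : C → ℝ) (E : Set S) (x y : C) :
    I (fun s => u ((SavageAct.glue E (SavageAct.const S x) (SavageAct.const S y)).1 s)) =
      u y + (u x - u y) * I (E.indicator fun _ => 1) := by
  rw [hI.glue]
  simp only [const_apply]
  rw [hI.indicator_const E, hI.indicator_const Eᶜ, hI.indicator_compl]
  ring

/-- Expected utility maximization with respect to a fine finitely additive probability. -/
theorem savageAxioms (hI : IsMean I) {u : C → ℝ} (hu : ∃ c c', u c ≠ u c') :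
    SavageAxioms fun f g : SavageAct S C => I (fun s => u (g.1 s)) ≤ I (fun s => u (f.1 s)) := by
  have const_le : ∀ x y : C, I (fun s => u ((SavageAct.const S y).1 s)) ≤
      I (fun s => u ((SavageAct.const S x).1 s)) ↔ u y ≤ u x := fun x y => by
    simp only [const_apply, hI.const]
  have strict : ∀ x y : C, StrictPref (fun f g : SavageAct S C =>
      I (fun s => u (g.1 s)) ≤ I (fun s => u (f.1 s))) (SavageAct.const S x) (SavageAct.const S y) ↔
      u y < u x := fun x y => by
    simp only [StrictPref, const_le, not_le]
    exact ⟨fun h => h.2, fun h => ⟨h.le, h⟩⟩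
  have bet_le : ∀ (E F : Set S) (x y : C), u y < u x →
      (I (fun s => u ((SavageAct.glue F (SavageAct.const S x) (SavageAct.const S y)).1 s)) ≤
        I (fun s => u ((SavageAct.glue E (SavageAct.const S x) (SavageAct.const S y)).1 s)) ↔
        I (F.indicator fun _ => 1) ≤ I (E.indicator fun _ => 1)) := fun E F x y h => by
    rw [hI.bet, hI.bet, add_le_add_iff_left, mul_le_mul_iff_right₀ (by linarith)]
  constructor
  · exact fun f g => le_total _ _
  · exact fun f g h h1 h2 => h2.trans h1
  · intro E f g h h'
    simp only [hI.glue]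
    simp
  · intro E hE x y h
    have hpos : 0 < I (E.indicator fun _ => 1) := by
      refine lt_of_le_of_ne (hI.indicator_nonneg E) fun h0 => hE ?_
      have hzero : ∀ f : SavageAct S C, I (E.indicator fun s => u (f.1 s)) = 0 := fun f => by
        obtain ⟨M, hM⟩ := isBoundedFun_utility u f
        have := hI.abs_indicator_le E hM
        rw [← h0, mul_zero] at this
        exact abs_nonpos_iff.1 this
      intro f g h
      simp [Indiff, hI.glue, hzero]
    rw [const_le]
    simp only [hI.glue, const_apply]
    rw [hI.indicator_const E (u x), hI.indicator_const E (u y), add_le_add_iff_right,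
      mul_le_mul_iff_left₀ hpos]
  · intro E F x y x' y' h h'
    rw [strict] at h h'
    exact (bet_le E F x y h).trans (bet_le E F x' y' h').symm
  · obtain ⟨c, c', hc⟩ := hu
    rcases hc.lt_or_gt with h | h
    · exact ⟨c', c, (strict _ _).2 h⟩
    · exact ⟨c, c', (strict _ _).2 h⟩
  · intro f g hfg x
    have hlt : I (fun s => u (g.1 s)) < I (fun s => u (f.1 s)) := not_le.1 hfg.2
    obtain ⟨M₁, hM₁⟩ := isBoundedFun_utility u f
    obtain ⟨M₂, hM₂⟩ := isBoundedFun_utility u g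
    obtain ⟨M, hM⟩ : ∃ M, M = max (max M₁ M₂) |u x| := ⟨_, rfl⟩
    have hMf : ∀ s, |u (f.1 s)| ≤ M := fun s =>
      (hM₁ s).trans (hM ▸ (le_max_left _ _).trans (le_max_left _ _))
    have hMg : ∀ s, |u (g.1 s)| ≤ M := fun s =>
      (hM₂ s).trans (hM ▸ (le_max_right _ _).trans (le_max_left _ _))
    have hMx : |u x| ≤ M := hM ▸ le_max_right _ _
    have hM0 : 0 ≤ M := (abs_nonneg _).trans hMx
    obtain ⟨n, hn⟩ := exists_nat_one_div_lt
      (show 0 < (I (fun s => u (f.1 s)) - I (fun s => u (g.1 s))) / (2 * M + 1) from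
        div_pos (sub_pos.2 hlt) (by positivity))
    rw [lt_div_iff₀ (by positivity)] at hn
    obtain ⟨k, q, hq⟩ := hI.exists_partition n
    refine ⟨k, q, fun i => ?_⟩
    have hdiff : ∀ h : SavageAct S C, (∀ s, |u (h.1 s)| ≤ M) →
        |I (fun s => u ((SavageAct.glue (q ⁻¹' {i}) (SavageAct.const S x) h).1 s)) -
          I (fun s => u (h.1 s))| < I (fun s => u (f.1 s)) - I (fun s => u (g.1 s)) := by
      intro h hh
      have h1 : I (fun s => u (h.1 s)) = I ((q ⁻¹' {i}).indicator fun s => u (h.1 s)) +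
          I ((q ⁻¹' {i})ᶜ.indicator fun s => u (h.1 s)) := by
        rw [← hI.glue]
        congr 1
        ext s
        simp [glue_apply]
      have h2 := hI.abs_indicator_le (q ⁻¹' {i}) hh
      have h3 := hI.abs_indicator_le (q ⁻¹' {i}) (φ := fun s => u ((SavageAct.const S x).1 s))
        (fun _ => hMx)
      have h4 := hI.indicator_nonneg (q ⁻¹' {i})
      have h5 := hq i
      rw [hI.glue, h1, add_sub_add_right_eq_sub]
      refine lt_of_le_of_lt (abs_sub _ _) ?_
      nlinarith
    have hf := abs_lt.1 (hdiff f hMf)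
    have hg := abs_lt.1 (hdiff g hMg)
    simp only [StrictPref, not_le]
    refine ⟨⟨?_, ?_⟩, ?_, ?_⟩ <;> linarith

end IsMean

/-! ### A fine mean on a refinement of the states -/

/-- The limit of the averages of the first `n` terms of a bounded sequence, along an ultrafilter. -/
noncomputable def averageLim (x : ℕ → ℝ) : ℝ :=
  ultraLim fun n => (∑ k ∈ Finset.range n, x k) / n

theorem abs_average_le {x : ℕ → ℝ} {M : ℝ} (hx : ∀ k, |x k| ≤ M) (n : ℕ) :
    |(∑ k ∈ Finset.range n, x k) / n| ≤ M := by
  have hM : 0 ≤ M := (abs_nonneg _).trans (hx 0)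
  rw [abs_div, Nat.abs_cast]
  refine div_le_of_le_mul₀ (by positivity) hM ?_
  refine (Finset.abs_sum_le_sum_abs _ _).trans ((Finset.sum_le_sum fun k _ => hx k).trans ?_)
  simp [mul_comm]

theorem averageLim_const (c : ℝ) : averageLim (fun _ => c) = c := by
  refine ultraLim_eq_of_tendsto_atTop (tendsto_const_nhds.congr' ?_)
  filter_upwards [Filter.eventually_gt_atTop 0] with n hn
  have hn' : (n : ℝ) ≠ 0 := by positivity
  simp [hn']

open Filter Topology in
theorem averageLim_indicator_mod_le (q i : ℕ) (hq : 0 < q) :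
    averageLim ({k | k % q = i}.indicator fun _ => 1) ≤ 1 / q := by
  have hx : ∀ k, |({k | k % q = i}.indicator (fun _ => (1 : ℝ))) k| ≤ 1 := fun k => by
    by_cases h : k % q = i <;> simp [h]
  have hlim : Tendsto (fun n : ℕ => 1 / (q : ℝ) + 1 / n) atTop (𝓝 (1 / q + 0)) :=
    tendsto_const_nhds.add tendsto_one_div_atTop_nhds_zero_nat
  rw [add_zero] at hlim
  refine le_of_tendsto_of_tendsto (tendsto_ultraLim (abs_average_le hx))
    (hlim.mono_left Nat.hyperfilter_le_atTop) ?_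
  refine Eventually.filter_mono Nat.hyperfilter_le_atTop ?_
  filter_upwards [eventually_gt_atTop 0] with n hn
  have hn' : (0 : ℝ) < n := by exact_mod_cast hn
  have hsum : ∑ k ∈ Finset.range n, ({k | k % q = i}.indicator (fun _ => (1 : ℝ))) k ≤
      n / q + 1 := by
    have h1 : ∑ k ∈ Finset.range n, ({k | k % q = i}.indicator (fun _ => (1 : ℝ))) k ≤
        Nat.count (· ≡ i [MOD q]) n := by
      rw [Nat.count_eq_card_filter_range, Finset.card_filter]
      push_cast
      refine Finset.sum_le_sum fun k _ => ?_
      by_cases h : k % q = i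
      · have : k ≡ i [MOD q] := by rw [← h]; exact (Nat.mod_modEq k q).symm
        simp [h, this]
      · simp only [Set.indicator, Set.mem_ofPred_eq, h, if_false]
        split_ifs <;> norm_num
    refine h1.trans ?_
    rw [Nat.count_modEq_card _ hq]
    have h2 : ((n / q : ℕ) : ℝ) ≤ n / q := Nat.cast_div_le
    split_ifs <;> push_cast <;> linarith
  rw [div_le_iff₀ hn']
  refine hsum.trans (le_of_eq ?_)
  field_simp

/-- A finitely supported probability with weights `w` at the points `ω` of `Ω` becomes fine on the
refinement `Ω × ℕ` when each point mass is spread uniformly over a copy of `ℕ`. -/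
theorem isMean_sum_averageLim {Ω R : Type*} [Fintype R] (ω : R → Ω) {w : R → ℝ}
    (hw0 : ∀ ρ, 0 ≤ w ρ) (hw1 : ∑ ρ, w ρ = 1) :
    IsMean fun φ : Ω × ℕ → ℝ => ∑ ρ, w ρ * averageLim fun k => φ (ω ρ, k) where
  add := by
    rintro φ ψ ⟨M, hM⟩ ⟨M', hM'⟩
    rw [← Finset.sum_add_distrib]
    refine Finset.sum_congr rfl fun ρ _ => ?_
    rw [← mul_add]
    congr 1
    unfold averageLim
    rw [← ultraLim_add (abs_average_le fun k => hM _) (abs_average_le fun k => hM' _)]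
    congr 1
    ext n
    rw [Finset.sum_add_distrib, add_div]
  const_mul := by
    rintro c φ ⟨M, hM⟩
    rw [Finset.mul_sum]
    refine Finset.sum_congr rfl fun ρ _ => ?_
    rw [mul_left_comm]
    congr 1
    unfold averageLim
    rw [← ultraLim_const_mul c (abs_average_le fun k => hM _)]
    congr 1
    ext n
    rw [← Finset.mul_sum, mul_div_assoc]
  mono := by
    rintro φ ψ ⟨M, hM⟩ ⟨M', hM'⟩ h
    refine Finset.sum_le_sum fun ρ _ => mul_le_mul_of_nonneg_left ?_ (hw0 ρ)
    refine ultraLim_mono (abs_average_le fun k => hM _) (abs_average_le fun k => hM' _) fun n => ?_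
    exact div_le_div_of_nonneg_right (Finset.sum_le_sum fun k _ => h _) (Nat.cast_nonneg n)
  one := by
    simp [averageLim_const, hw1]
  exists_partition := by
    intro n
    refine ⟨n + 1, fun s => ⟨s.2 % (n + 1), Nat.mod_lt _ n.succ_pos⟩, fun i => ?_⟩
    have h1 : ∀ ρ, (fun k => ((fun s : Ω × ℕ => (⟨s.2 % (n + 1), Nat.mod_lt _ n.succ_pos⟩ :
        Fin (n + 1))) ⁻¹' {i}).indicator (fun _ => (1 : ℝ)) (ω ρ, k)) =
        {k | k % (n + 1) = i}.indicator fun _ => 1 := fun ρ => by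
      ext k
      simp [Set.indicator, Fin.ext_iff]
    simp only [h1]
    rw [← Finset.sum_mul, hw1, one_mul]
    have := averageLim_indicator_mod_le (n + 1) i n.succ_pos
    push_cast at this
    exact this

/-! ### The joint response of a causal environment to all actions -/

namespace UncertainEnvironment

variable {V : Type*} {Val : V → Type*} {Ω : Type*} (D : UncertainEnvironment V Val Ω)

/-- The response of the state `ω` to all actions at once, including the counterfactual ones. -/
def jointResponse (ω : Ω) (a : D.Action) : (v : V) → Val v := D.response a ω

theorem finite_range_jointResponse [Finite D.Action] : (Set.range D.jointResponse).Finite :=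
  (Set.Finite.pi fun a => D.finite_range_response a).subset (by
    rintro _ ⟨ω, rfl⟩ a -
    exact ⟨ω, rfl⟩)

instance [Finite D.Action] : Finite (Set.range D.jointResponse) :=
  D.finite_range_jointResponse.to_subtype

noncomputable instance [Finite D.Action] : Fintype (Set.range D.jointResponse) :=
  Fintype.ofFinite _

theorem finite_outcomes [Finite D.Action] : {c | ∃ a ω, D.outcome a ω = c}.Finite := by
  refine (Set.finite_iUnion fun a => (D.finite_range_response a).image fun x =>
    x D.outcomeVar).subset ?_
  rintro _ ⟨a, ω, rfl⟩
  exact Set.mem_iUnion.2 ⟨a, _, ⟨ω, rfl⟩, rfl⟩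

theorem response_eq_mem_events [Finite V] (a : D.Action) (x : (v : V) → Val v) :
    {ω | D.response a ω = x} ∈ D.events := by
  have := Fintype.ofFinite V
  have h := D.isSetAlgebra_events.biInter_mem (s := fun v => {ω | D.response a ω v = x v})
    Finset.univ fun v _ => D.response_mem_events a v (x v)
  convert! h using 1
  ext ω
  simp [funext_iff]

theorem jointResponse_eq_mem_events [Finite V] [Finite D.Action]
    (ρ : D.Action → (v : V) → Val v) : {ω | D.jointResponse ω = ρ} ∈ D.events := by
  have := Fintype.ofFinite D.Action
  have h := D.isSetAlgebra_events.biInter_mem (s := fun a => {ω | D.response a ω = ρ a})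
    Finset.univ fun a _ => D.response_eq_mem_events a (ρ a)
  convert! h using 1
  ext ω
  simp [funext_iff, jointResponse]

open Classical in
/-- An event that is determined by the joint response is a finite union of joint-response events. -/
theorem content_eq_sum [Finite V] [Finite D.Action]
    (μ : MeasureTheory.AddContent ENNReal D.events) {A : Set Ω} (hA : A ∈ D.events)
    (P : (D.Action → (v : V) → Val v) → Prop) (hP : ∀ ω, ω ∈ A ↔ P (D.jointResponse ω)) :
    μ A = ∑ ρ : Set.range D.jointResponse, if P ρ then μ {ω | D.jointResponse ω = ρ} else 0 := by
  have hU : A = ⋃ ρ ∈ Finset.univ.filter fun ρ : Set.range D.jointResponse => P ρ,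
      {ω | D.jointResponse ω = ρ} := by
    ext ω
    simp only [hP, Finset.mem_filter, Finset.mem_univ, true_and, Set.mem_iUnion,
      Set.mem_ofPred_eq, exists_prop]
    constructor
    · exact fun h => ⟨⟨D.jointResponse ω, ω, rfl⟩, h, rfl⟩
    · rintro ⟨ρ, h, h'⟩
      rwa [h']
  rw [← Finset.sum_filter, ← MeasureTheory.addContent_biUnion
    (fun ρ _ => D.jointResponse_eq_mem_events _) _ (hU ▸ hA), ← hU]
  rintro ρ - ρ' - hne
  refine Set.disjoint_left.2 fun ω hω hω' => hne (Subtype.ext ?_)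
  exact (show D.jointResponse ω = ρ from hω) ▸ hω'

theorem sum_content_jointResponse [Finite V] [Finite D.Action]
    {μ : MeasureTheory.AddContent ENNReal D.events} (hμ : μ Set.univ = 1) :
    ∑ ρ : Set.range D.jointResponse, μ {ω | D.jointResponse ω = ρ} = 1 := by
  rw [← hμ, D.content_eq_sum μ D.isSetAlgebra_events.univ_mem (fun _ => True) (by simp)]
  simp

open Classical in
/-- The interventional distribution of the outcome, in terms of the joint response. -/
theorem doProb_eq_sum [Fintype V] [Finite D.Action] {g : CausalModel V Val}
    {μ : MeasureTheory.AddContent ENNReal D.events}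
    (hg : ∀ (a : D.Action) (x : (v : V) → Val v),
      g.doJoint D.actionVar a x = μ {ω | D.response a ω = x}) (a : D.Action)
    (c : D.Consequence) :
    g.doProb D.actionVar a D.outcomeVar c = ∑ ρ : Set.range D.jointResponse,
      if ρ.1 a D.outcomeVar = c then μ {ω | D.jointResponse ω = ρ} else 0 := by
  have h1 : ∀ x, g.doJoint D.actionVar a x = ∑ ρ : Set.range D.jointResponse,
      if ρ.1 a = x then μ {ω | D.jointResponse ω = ρ} else 0 := fun x => by
    rw [hg, D.content_eq_sum μ (D.response_eq_mem_events a x) (fun ρ => ρ a = x)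
      fun ω => Iff.rfl]
    exact Finset.sum_congr rfl fun ρ _ => by congr
  simp only [CausalModel.doProb, h1]
  rw [Summable.tsum_finsetSum fun _ _ => ENNReal.summable]
  refine Finset.sum_congr rfl fun ρ _ => ?_
  split_ifs with hc
  · rw [tsum_eq_single ⟨ρ.1 a, hc⟩]
    · simp
    · rintro ⟨x, hx⟩ hne
      rw [if_neg]
      rintro rfl
      exact hne rfl
  · refine ENNReal.tsum_eq_zero.2 ?_
    rintro ⟨x, hx⟩
    rw [if_neg]
    rintro rfl
    exact hc hx

open Classical in
theorem toReal_doProb_eq_sum [Fintype V] [Finite D.Action] {g : CausalModel V Val}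
    {μ : MeasureTheory.AddContent ENNReal D.events} (hμ : μ Set.univ = 1)
    (hg : ∀ (a : D.Action) (x : (v : V) → Val v),
      g.doJoint D.actionVar a x = μ {ω | D.response a ω = x}) (a : D.Action)
    (c : D.Consequence) :
    (g.doProb D.actionVar a D.outcomeVar c).toReal = ∑ ρ : Set.range D.jointResponse,
      if ρ.1 a D.outcomeVar = c then (μ {ω | D.jointResponse ω = ρ}).toReal else 0 := by
  have hfin : ∀ ρ : Set.range D.jointResponse, μ {ω | D.jointResponse ω = ρ} ≠ ⊤ := fun ρ =>
    ne_top_of_le_ne_top ENNReal.one_ne_top ((Finset.single_le_sum (fun _ _ => zero_le)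
      (Finset.mem_univ ρ)).trans (D.sum_content_jointResponse hμ).le)
  rw [D.doProb_eq_sum hg, ENNReal.toReal_sum]
  · refine Finset.sum_congr rfl fun ρ _ => ?_
    split_ifs <;> rfl
  · intro ρ _
    split_ifs
    · exact hfin ρ
    · simp

/-! ### Deterministic causal models -/

open Classical in
/-- The deterministic causal model in which the action is the only cause of all other variables,
which respond to it as they do in the state `ω`. The value of the action without intervention is
irrelevant; it is set to `a₀`. -/
noncomputable def stateModel (a₀ : D.Action) (ω : Ω) : CausalModel V Val where
  edge w v := w = D.actionVar ∧ v ≠ D.actionVar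
  acyclic v h := by
    obtain ⟨w, -, hwv⟩ := Relation.TransGen.tail'_iff.1 h
    obtain ⟨w', hvw, -⟩ := Relation.TransGen.head'_iff.1 h
    exact hwv.2 hvw.1
  cpd v pa := PMF.pure (D.response
    (if h : v = D.actionVar then a₀ else pa ⟨D.actionVar, rfl, h⟩) ω v)

open Classical in
theorem doJoint_stateModel [Fintype V] (a₀ : D.Action) (ω : Ω) (a : D.Action)
    (x : (v : V) → Val v) :
    (D.stateModel a₀ ω).doJoint D.actionVar a x = if D.response a ω = x then 1 else 0 := by
  unfold CausalModel.doJoint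
  by_cases hx : x D.actionVar = a
  · rw [if_pos hx]
    have hfactor : ∀ v ∈ Finset.univ.erase D.actionVar,
        (D.stateModel a₀ ω).cpd v (fun w => x w) (x v) =
          if x v = D.response a ω v then 1 else 0 := fun v hv => by
      have hv' : v ≠ D.actionVar := Finset.ne_of_mem_erase hv
      simp [stateModel, PMF.pure_apply, hv', hx]
    rw [Finset.prod_congr rfl hfactor]
    split_ifs with h
    · exact Finset.prod_eq_one fun v _ => by simp [← h]
    · obtain ⟨v, hv⟩ := Function.ne_iff.1 h
      have hv' : v ≠ D.actionVar := by
        rintro rfl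
        exact hv (by rw [D.response_actionVar, hx])
      exact Finset.prod_eq_zero (Finset.mem_erase.2 ⟨hv', Finset.mem_univ v⟩)
        (if_neg (Ne.symm hv))
  · rw [if_neg hx, if_neg]
    rintro rfl
    exact hx (D.response_actionVar a ω)

open Classical in
/-- The point mass at the state `ω`. -/
noncomputable def diracContent (ω : Ω) : MeasureTheory.AddContent ENNReal D.events :=
  D.isSetAlgebra_events.isSetRing.addContent_of_union (fun A => if ω ∈ A then 1 else 0) (by simp)
    (by
      intro s t _ _ hst
      rw [Set.disjoint_left] at hst
      by_cases hs : ω ∈ s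
      · simp [hs, hst hs]
      · simp [hs])

open Classical in
theorem diracContent_apply (ω : Ω) (A : Set Ω) :
    D.diracContent ω A = if ω ∈ A then 1 else 0 := rfl

theorem controls_stateModel_dirac [Fintype V] (a₀ : D.Action) (ω : Ω) (a : D.Action)
    (x : (v : V) → Val v) :
    (D.stateModel a₀ ω).doJoint D.actionVar a x = D.diracContent ω {ω | D.response a ω = x} := by
  rw [doJoint_stateModel, diracContent_apply]
  congr

theorem controls_stateModel [Fintype V] (a₀ : D.Action) (ω : Ω) :
    D.Controls (D.stateModel a₀ ω) :=
  ⟨D.diracContent ω, by simp [diracContent_apply], D.controls_stateModel_dirac a₀ ω⟩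

open Classical in
theorem toReal_doProb_stateModel [Fintype V] [Finite D.Action] (a₀ : D.Action) (ω : Ω)
    (a : D.Action) (c : D.Consequence) :
    ((D.stateModel a₀ ω).doProb D.actionVar a D.outcomeVar c).toReal =
      if D.outcome a ω = c then 1 else 0 := by
  rw [D.toReal_doProb_eq_sum (by simp [diracContent_apply]) (D.controls_stateModel_dirac a₀ ω),
    Finset.sum_eq_single ⟨D.jointResponse ω, ω, rfl⟩]
  · simp only [diracContent_apply, outcome, jointResponse, Set.mem_ofPred_eq, if_true,
      ENNReal.toReal_one]
    congr
  · intro ρ _ hne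
    have : D.jointResponse ω ≠ ρ := fun h => hne (Subtype.ext h.symm)
    simp [diracContent_apply, this]
  · simp

end UncertainEnvironment

/-! ### Causal expected utility -/

open Classical in
theorem tsum_mul_toReal_map {R G : Type*} [Fintype R] (P : PMF R) (f : R → G) (φ : G → ℝ) :
    ∑' g, φ g * (P.map f g).toReal = ∑ ρ, φ (f ρ) * (P ρ).toReal := by
  have h1 : ∀ g, φ g * (P.map f g).toReal =
      ∑ ρ, if g = f ρ then φ (f ρ) * (P ρ).toReal else 0 := fun g => by
    rw [PMF.map_apply, tsum_fintype, ENNReal.toReal_sum, Finset.mul_sum]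
    · refine Finset.sum_congr rfl fun ρ _ => ?_
      split_ifs with h
      · rw [h]
      · simp
    · intro ρ _
      split_ifs
      · exact P.apply_ne_top ρ
      · simp
  simp only [h1]
  rw [Summable.tsum_finsetSum fun ρ _ => (hasSum_ite_eq _ _).summable]
  exact Finset.sum_congr rfl fun ρ _ => tsum_ite_eq _ _

namespace CausalDecisionProblem

variable {V : Type*} [Fintype V] {Val : V → Type*} {Ω : Type*}
  (D : CausalDecisionProblem V Val Ω)

open Classical in
theorem causalUtility_eq_sum [Finite D.Action] (u : D.Consequence → ℝ)
    (F : Set (CausalModel V Val)) (P_C : PMF F) (a : D.Action)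
    (w : Set.range D.jointResponse → ℝ)
    (hw : ∀ c, ∑' g : F, (g.1.doProb D.actionVar a D.outcomeVar c).toReal * (P_C g).toReal =
      ∑ ρ, if ρ.1 a D.outcomeVar = c then w ρ else 0) :
    D.causalUtility u F P_C a = ∑ ρ, w ρ * u (ρ.1 a D.outcomeVar) := by
  unfold causalUtility
  simp only [hw, Finset.mul_sum]
  have h1 : ∀ (ρ : Set.range D.jointResponse) (c : D.Consequence),
      u c * (if ρ.1 a D.outcomeVar = c then w ρ else 0) =
        if c = ρ.1 a D.outcomeVar then w ρ * u (ρ.1 a D.outcomeVar) else 0 := fun ρ c => by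
    by_cases h : ρ.1 a D.outcomeVar = c
    · simp [h, mul_comm]
    · simp [h, Ne.symm h]
  simp only [h1]
  rw [Summable.tsum_finsetSum fun ρ _ => (hasSum_ite_eq _ _).summable]
  exact Finset.sum_congr rfl fun ρ _ => tsum_ite_eq _ _

/-- Any probability on the joint responses is a mixture of deterministic causal models. -/
theorem exists_mixture [Finite D.Action] [Nonempty D.Action] (u : D.Consequence → ℝ)
    {w : Set.range D.jointResponse → ℝ} (hw0 : ∀ ρ, 0 ≤ w ρ) (hw1 : ∑ ρ, w ρ = 1) :
    ∃ (F : Set (CausalModel V Val)) (P_C : PMF F), (∀ g ∈ F, D.Controls g) ∧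
      ∀ a, D.causalUtility u F P_C a = ∑ ρ, w ρ * u (ρ.1 a D.outcomeVar) := by
  obtain ⟨a₀⟩ := ‹Nonempty D.Action›
  choose ω hω using fun ρ : Set.range D.jointResponse => ρ.2
  let P : PMF (Set.range D.jointResponse) := PMF.ofFintype (fun ρ => ENNReal.ofReal (w ρ)) (by
    rw [← ENNReal.ofReal_sum_of_nonneg fun ρ _ => hw0 ρ, hw1, ENNReal.ofReal_one])
  let model : Set.range D.jointResponse → CausalModel V Val := fun ρ => D.stateModel a₀ (ω ρ)
  refine ⟨Set.range model, P.map (Set.rangeFactorization model), ?_, fun a => ?_⟩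
  · rintro _ ⟨ρ, rfl⟩
    exact D.controls_stateModel a₀ (ω ρ)
  · refine D.causalUtility_eq_sum u _ _ a w fun c => ?_
    rw [tsum_mul_toReal_map P _ fun g : Set.range model =>
      (g.1.doProb D.actionVar a D.outcomeVar c).toReal]
    refine Finset.sum_congr rfl fun ρ _ => ?_
    have h1 : (P ρ).toReal = w ρ := by
      rw [PMF.ofFintype_apply, ENNReal.toReal_ofReal (hw0 ρ)]
    have h2 : D.outcome a (ω ρ) = ρ.1 a D.outcomeVar := by
      rw [← hω ρ]
      rfl
    have h3 := D.toReal_doProb_stateModel a₀ (ω ρ) a c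
    rw [h1, show ((Set.rangeFactorization model ρ).1.doProb D.actionVar a D.outcomeVar c).toReal = _
      from h3, h2]
    split_ifs <;> simp

open Classical in
/-- A mixture of causal models that control the environment comes from a probability on the joint
responses: the mixture of the contents that witness the control. -/
theorem exists_weights [Finite D.Action] {F : Set (CausalModel V Val)} (P_C : PMF F)
    (hF : ∀ g ∈ F, D.Controls g) :
    ∃ w : Set.range D.jointResponse → ℝ, (∀ ρ, 0 ≤ w ρ) ∧ ∑ ρ, w ρ = 1 ∧
      ∀ (u : D.Consequence → ℝ) a,
        D.causalUtility u F P_C a = ∑ ρ, w ρ * u (ρ.1 a D.outcomeVar) := by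
  choose μ hμ hg using fun g : F => hF g.1 g.2
  let m : F → Set.range D.jointResponse → ℝ := fun g ρ => (μ g {ω | D.jointResponse ω = ρ}).toReal
  have hm0 : ∀ g ρ, 0 ≤ m g ρ := fun g ρ => ENNReal.toReal_nonneg
  have hm1 : ∀ g, ∑ ρ, m g ρ = 1 := fun g => by
    have h := D.sum_content_jointResponse (hμ g)
    rw [← ENNReal.toReal_sum, h, ENNReal.toReal_one]
    exact fun ρ _ => ne_top_of_le_ne_top ENNReal.one_ne_top
      ((Finset.single_le_sum (fun _ _ => zero_le) (Finset.mem_univ ρ)).trans h.le)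
  have hP : HasSum (fun g => (P_C g).toReal) 1 := by
    have := ENNReal.hasSum_toReal (f := P_C) (by rw [P_C.tsum_coe]; exact ENNReal.one_ne_top)
    rwa [← ENNReal.tsum_toReal_eq P_C.apply_ne_top, P_C.tsum_coe, ENNReal.toReal_one] at this
  have hsum : ∀ ρ, Summable fun g => m g ρ * (P_C g).toReal := fun ρ =>
    Summable.of_nonneg_of_le (fun g => mul_nonneg (hm0 g ρ) ENNReal.toReal_nonneg)
      (fun g => mul_le_of_le_one_left ENNReal.toReal_nonneg
        ((Finset.single_le_sum (fun ρ _ => hm0 g ρ) (Finset.mem_univ ρ)).trans (hm1 g).le))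
      hP.summable
  refine ⟨fun ρ => ∑' g, m g ρ * (P_C g).toReal,
    fun ρ => tsum_nonneg fun g => mul_nonneg (hm0 g ρ) ENNReal.toReal_nonneg, ?_, fun u a => ?_⟩
  · rw [← Summable.tsum_finsetSum fun ρ _ => hsum ρ]
    simp only [← Finset.sum_mul, hm1, one_mul]
    exact hP.tsum_eq
  · refine D.causalUtility_eq_sum u F P_C a _ fun c => ?_
    have h1 : ∀ g : F, (g.1.doProb D.actionVar a D.outcomeVar c).toReal * (P_C g).toReal =
        ∑ ρ : Set.range D.jointResponse,
          if ρ.1 a D.outcomeVar = c then m g ρ * (P_C g).toReal else 0 := fun g => by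
      rw [D.toReal_doProb_eq_sum (hμ g) (hg g), Finset.sum_mul]
      exact Finset.sum_congr rfl fun ρ _ => by split_ifs <;> simp [m]
    simp only [h1]
    rw [Summable.tsum_finsetSum]
    · refine Finset.sum_congr rfl fun ρ _ => ?_
      split_ifs <;> simp
    · intro ρ _
      split_ifs
      · exact hsum ρ
      · exact summable_zero

open Classical in
theorem sum_utility_mul_toAct [Finite D.Action] {S : Type*} {p : Set S → ℝ}
    (hp : IsFinitelyAdditive p) (π : S → Ω) (u : D.Consequence → ℝ) (K : Finset D.Consequence)
    (a : D.Action) (hK : ∀ ω, D.outcome a ω ∈ K) :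
    ∑ c ∈ K, u c * p ((D.toAct π a).1 ⁻¹' {c}) =
      ∑ ρ : Set.range D.jointResponse,
        p ((Set.rangeFactorization D.jointResponse ∘ π) ⁻¹' {ρ}) * u (ρ.1 a D.outcomeVar) := by
  have h1 : ∀ c, p ((D.toAct π a).1 ⁻¹' {c}) = ∑ ρ : Set.range D.jointResponse,
      if ρ.1 a D.outcomeVar = c then p ((Set.rangeFactorization D.jointResponse ∘ π) ⁻¹' {ρ})
      else 0 := fun c => by
    rw [← hp.sum_inter_preimage _ (Set.rangeFactorization D.jointResponse ∘ π)]
    refine Finset.sum_congr rfl fun ρ _ => ?_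
    have h2 : ∀ s, (Set.rangeFactorization D.jointResponse ∘ π) s = ρ →
        (D.toAct π a).1 s = ρ.1 a D.outcomeVar := by
      rintro s rfl
      rfl
    split_ifs with h
    · congr 1
      ext s
      simp only [Set.mem_inter_iff, Set.mem_preimage, Set.mem_singleton_iff, and_iff_right_iff_imp]
      exact fun hs => (h2 s hs).trans h
    · rw [← hp.empty]
      congr 1
      ext s
      simp only [Set.mem_inter_iff, Set.mem_preimage, Set.mem_singleton_iff,
        Set.mem_empty_iff_false, iff_false, not_and]
      exact fun hs hs' => h ((h2 s hs').symm.trans hs)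
  simp only [h1, Finset.mul_sum]
  rw [Finset.sum_comm]
  refine Finset.sum_congr rfl fun ρ _ => ?_
  have hρ : ρ.1 a D.outcomeVar ∈ K := by
    obtain ⟨_, ω, rfl⟩ := ρ
    exact hK ω
  rw [Finset.sum_eq_single_of_mem _ hρ]
  · simp [mul_comm]
  · intro c _ hc
    simp [Ne.symm hc]

theorem exists_causalUtility_of_savageRational [Finite D.Action] (h : D.SavageRational) :
    ∃ (u : D.Consequence → ℝ) (F : Set (CausalModel V Val)) (P_C : PMF F),
      (∃ c c', u c ≠ u c') ∧ (∀ g ∈ F, D.Controls g) ∧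
      ∀ a b : D.Action, D.pref a b ↔
        D.causalUtility u F P_C a ≥ D.causalUtility u F P_C b := by
  obtain ⟨S, π, pref', -, ax, hpref⟩ := h
  obtain ⟨K, p, u, hK, hp, hp1, hu, hrep⟩ :=
    ax.exists_expectedUtility D.finite_outcomes.toFinset
  have hmem : ∀ a ω, D.outcome a ω ∈ K := fun a ω => hK (by simp)
  cases isEmpty_or_nonempty D.Action with
  | inl hempty =>
    exact ⟨u, {D.model}, PMF.pure ⟨D.model, rfl⟩, hu, by
      rintro _ rfl; exact D.controls_model, fun a => hempty.elim a⟩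
  | inr hne =>
    obtain ⟨F, P_C, hF, hU⟩ := D.exists_mixture u
      (w := fun ρ => p ((Set.rangeFactorization D.jointResponse ∘ π) ⁻¹' {ρ}))
      (fun ρ => hp.nonneg _) (by
        have := hp.sum_inter_preimage Set.univ (Set.rangeFactorization D.jointResponse ∘ π)
        simpa [hp1] using this)
    refine ⟨u, F, P_C, hu, hF, fun a b => ?_⟩
    rw [hpref, hrep _ _ (fun s => hmem a _) (fun s => hmem b _), hU, hU,
      D.sum_utility_mul_toAct hp π u K a (hmem a), D.sum_utility_mul_toAct hp π u K b (hmem b)]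

theorem savageRational_of_causalUtility [Finite D.Action] {u : D.Consequence → ℝ}
    {F : Set (CausalModel V Val)} {P_C : PMF F} (hu : ∃ c c', u c ≠ u c')
    (hF : ∀ g ∈ F, D.Controls g)
    (hpref : ∀ a b : D.Action, D.pref a b ↔
      D.causalUtility u F P_C a ≥ D.causalUtility u F P_C b) : D.SavageRational := by
  obtain ⟨w, hw0, hw1, hU⟩ := D.exists_weights P_C hF
  choose ω hω using fun ρ : Set.range D.jointResponse => ρ.2
  have hI := isMean_sum_averageLim ω hw0 hw1
  refine ⟨Ω × ℕ, Prod.fst, _, ?_, hI.savageAxioms hu, fun a b => ?_⟩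
  · exact fun x => ⟨(x, 0), rfl⟩
  · have h1 : ∀ a : D.Action, ∑ ρ, w ρ * averageLim (fun k =>
        u ((D.toAct (Prod.fst : Ω × ℕ → Ω) a).1 (ω ρ, k))) = D.causalUtility u F P_C a := by
      intro a
      rw [hU]
      refine Finset.sum_congr rfl fun ρ _ => ?_
      have h2 : ∀ k : ℕ, (D.toAct (Prod.fst : Ω × ℕ → Ω) a).1 (ω ρ, k) =
          ρ.1 a D.outcomeVar := fun k => by
        rw [← hω ρ]
        rfl
      simp only [h2, averageLim_const]
    rw [hpref, ← h1, ← h1]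

end CausalDecisionProblem

theorem theorem1 {V : Type*} [Fintype V] {Val : V → Type*} {Ω : Type*}
    (D : CausalDecisionProblem V Val Ω) (hfin : Finite D.Action) :
    D.SavageRational ↔
      ∃ (u : D.Consequence → ℝ) (F : Set (CausalModel V Val)) (P_C : PMF F),
        (∃ c c', u c ≠ u c') ∧
        (∀ g ∈ F, D.Controls g) ∧
        ∀ a b : D.Action, D.pref a b ↔
          D.causalUtility u F P_C a ≥ D.causalUtility u F P_C b := by
  refine ⟨fun h => D.exists_causalUtility_of_savageRational h, ?_⟩
  rintro ⟨u, F, P_C, hu, hF, hpref⟩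
  exact D.savageRational_of_causalUtility hu hF hpref
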